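/- **Setting.** Let $n\ge 1$, let $\langle z,w\rangle=z_1\bar w_1+\dots+z_n\bar w_n-z_{n+1}\bar w_{n+1}$ on $\mathbb C^{n+1}$, and let $G=SU(n,1)$ be the group of matrices in $SL(n+1,\mathbb C)$ preserving this form; $U(n,1)$ is defined likewise in $GL(n+1,\mathbb C)$. $G$ acts on the unit ball $B^n\subset\mathbb C^n$ by fractional linear maps, a point $z$ being identified with the vector $(z,1)$. For $g=\begin{pmatrix}A&b\\c&d\end{pmatrix}\in G$ put $j(g,z)=(c\cdot z+d)^{-1}$. Let $dV=4^n(1-|z|^2)^{-(n+1)}dV_E$ on $B^n$, where $dV_E$ is Lebesgue measure, and let $dg$ be the Haar measure on $G$ whose image under $g\mapsto g(0)$ is $dV$. Let $\Gamma\subset G$ be a lattice. Let $\kappa\ge1$ be a half-integer such that $m:=(n+1)\kappa$ is an integer. $S_{2m}(\Gamma)$ is the space of holomorphic $f:B^n\to\mathbb C$ with $(f|\gamma)(z):=f(\gamma z)\,j(\gamma,z)^{2m}=f(z)$ for all $\gamma\in\Gamma$, $z\in B^n$, whose lift $\tilde f(g)=f(g(0))\,j(g,0)^{2m}$ is bounded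 on $G$. The Petersson product is $(f_1,f_2)=\int_{\Gamma\backslash G}\tilde f_1\,\overline{\tilde f_2}\,dg$. Let $a_t\in G$ be the matrix acting on the last two coordinates by $\begin{pmatrix}\cosh t&\sinh t\\ \sinh t&\cosh t\end{pmatrix}$ and trivially on the others; right multiplication by $a_t$ is the frame flow. Let $W=\{\mathrm{diag}(u,e^{-i\psi},e^{-i\psi})\in G: u\in U(n-1),\ \psi\in\mathbb R\}$. An element of $G$ is loxodromic if it is conjugate in $G$ to some $a_tw$ with $t\neq0$, $w\in W$. Let $\gamma_0\in\Gamma$ be loxodromic, and let $X$ and $Y$ be its attracting and repelling fixed points on $\partial B^n$, written as null vectors with last coordinate $1$. Put $$q(z)=\bigl(\langle z,X\rangle\langle z,Y\rangle\bigr)^{-m},\qquad \Theta_{\gamma_0,\kappa}=\sum_{\gamma\in\langle\gamma_0\rangle\backslash\Gamma}q|\gamma,\qquad \alpha=-\frac{\langle X,Y\rangle}{2},$$ $$C=\frac{(2m-n-1)!}{((m-1)!)^2}\,\pi^n\,2^{2(n+1)-2m-1}=\frac{(2(n+1)\kappa-n-1)!}{(((n+1)\kappa-1)!)^2}\,\pi^n\,2^{2(n+1)(1-\kappa)-1}.$$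 Assume that $q|\gamma_0=q$, so that the terms of the series depend only on the coset of $\gamma$. (Equivalently, $(\lambda/\bar\lambda)^m=1$, where $\gamma_0X=\lambda X$; this holds whenever $\lambda$ is real, in particular always for $n=1$.) A lift of the closed geodesic $[\gamma_0]$ is an orbit segment $\{ga_t:0\le t\le s\}$, with $g\in G$ and $s>0$, such that $\gamma_0\cdot\bigl(ga_t(0)\bigr)=ga_{t+s}(0)$ for all $t\in\mathbb R$. Fix $T\in U(n,1)$ whose last two columns are $\frac{X}{\langle X,Y\rangle}+\frac Y2$ and $\frac{X}{\langle X,Y\rangle}-\frac Y2$ (for $n\ge2$ one may take $T\in SU(n,1)$). **Theorem.** Let $f\in S_{2m}(\Gamma)$. The series $\Theta_{\gamma_0,\kappa}$ converges absolutely at every point of $B^n$, and the integral defining $(f,\Theta_{\gamma_0,\kappa})$ converges absolutely. Every lift $\{ga_t:0\le t\le s\}$ of $[\gamma_0]$ has the form $g=Ta_rw$ with $r\in\mathbb R$ and $w=\mathrm{diag}(u,e^{-i\psi},e^{-i\psi})$, $u\in U(n-1)$, $\psi\in\mathbb R$ (so $w\in W$ and $\det u=e^{2i\psi}$ if $T\in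 SU(n,1)$); denote this lift by $[\gamma_0]_w$. For every such lift, and every such representation of $g$, $$(f,\Theta_{\gamma_0,\kappa})=e^{-2(n+1)\kappa\, i\psi}\,\alpha^{-(n+1)\kappa}\,C\int_{[\gamma_0]_w}\tilde f\,dt,\qquad \int_{[\gamma_0]_w}\tilde f\,dt=\int_0^s\tilde f(ga_t)\,dt .$$ -/

import Mathlib

open MeasureTheory Matrix
open scoped Nat

noncomputable section

namespace ComplexHyperbolic

/-! ### The form of signature `(n,1)`, the group `SU(n,1)` and the unit ball

Vectors of `ℂ^{n,1}` are functions on `Fin n ⊕ Unit`; `inr ()` is the last (negative) coordinate,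
and `inl ⊤` is the `n`-th coordinate. -/

/-- The Hermitian form `⟨z,w⟩ = z₁ w̄₁ + ⋯ + zₙ w̄ₙ - zₙ₊₁ w̄ₙ₊₁`. -/
def herm {n : ℕ} (z w : Fin n ⊕ Unit → ℂ) : ℂ :=
  ∑ i : Fin n, z (Sum.inl i) * star (w (Sum.inl i)) - z (Sum.inr ()) * star (w (Sum.inr ()))

/-- The matrix `diag(1,…,1,-1)` of the form. -/
def formMatrix (n : ℕ) : Matrix (Fin n ⊕ Unit) (Fin n ⊕ Unit) ℂ :=
  Matrix.fromBlocks 1 0 0 (-1)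

/-- Membership in `U(n,1)`. -/
def PreservesForm {n : ℕ} (A : Matrix (Fin n ⊕ Unit) (Fin n ⊕ Unit) ℂ) : Prop :=
  Aᴴ * formMatrix n * A = formMatrix n

/-- The group `SU(n,1)`, with the topology and group structure coming from `SL(n+1,ℂ)`. -/
def SU (n : ℕ) : Subgroup (Matrix.SpecialLinearGroup (Fin n ⊕ Unit) ℂ) where
  carrier := {A | PreservesForm (A : Matrix (Fin n ⊕ Unit) (Fin n ⊕ Unit) ℂ)}
  one_mem' := by simp [PreservesForm]
  mul_mem' := by
    intro A B hA hB
    simp only [Set.mem_ofPred_eq, PreservesForm] at hA hB ⊢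
    rw [Matrix.SpecialLinearGroup.coe_mul, Matrix.conjTranspose_mul]
    calc _ = (B : Matrix (Fin n ⊕ Unit) (Fin n ⊕ Unit) ℂ)ᴴ *
          ((A : Matrix (Fin n ⊕ Unit) (Fin n ⊕ Unit) ℂ)ᴴ * formMatrix n * A) * B := by
            simp only [Matrix.mul_assoc]
      _ = _ := by rw [hA, hB]
  inv_mem' := by
    intro A hA
    simp only [Set.mem_ofPred_eq, PreservesForm] at hA ⊢
    have h1 : (A : Matrix (Fin n ⊕ Unit) (Fin n ⊕ Unit) ℂ) *
        ((A⁻¹ : Matrix.SpecialLinearGroup (Fin n ⊕ Unit) ℂ) :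
          Matrix (Fin n ⊕ Unit) (Fin n ⊕ Unit) ℂ) = 1 := by
      rw [← Matrix.SpecialLinearGroup.coe_mul, mul_inv_cancel, Matrix.SpecialLinearGroup.coe_one]
    have h2 := congrArg Matrix.conjTranspose h1
    rw [Matrix.conjTranspose_mul, Matrix.conjTranspose_one] at h2
    generalize ((A⁻¹ : Matrix.SpecialLinearGroup (Fin n ⊕ Unit) ℂ) :
          Matrix (Fin n ⊕ Unit) (Fin n ⊕ Unit) ℂ) = B at *
    calc Bᴴ * formMatrix n * B
        = Bᴴ * ((A : Matrix (Fin n ⊕ Unit) (Fin n ⊕ Unit) ℂ)ᴴ * formMatrix n * A) * B := by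
          rw [hA]
      _ = (Bᴴ * (A : Matrix (Fin n ⊕ Unit) (Fin n ⊕ Unit) ℂ)ᴴ) * formMatrix n *
            ((A : Matrix (Fin n ⊕ Unit) (Fin n ⊕ Unit) ℂ) * B) := by
          simp only [Matrix.mul_assoc]
      _ = formMatrix n := by rw [h1, h2, Matrix.one_mul, Matrix.mul_one]

/-- The underlying matrix of an element of `SU(n,1)`. -/
def mat {n : ℕ} (g : SU n) : Matrix (Fin n ⊕ Unit) (Fin n ⊕ Unit) ℂ := g.1.1

/-- The Borel `σ`-algebra on `SU(n,1)`. -/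
instance instMeasurableSpaceSU (n : ℕ) : MeasurableSpace (SU n) := borel _

instance instBorelSpaceSU (n : ℕ) : BorelSpace (SU n) := ⟨rfl⟩

/-- The unit ball `Bⁿ` of `ℂⁿ` for the Euclidean norm. -/
def ball (n : ℕ) : Set (Fin n → ℂ) := {z | ∑ i, ‖z i‖ ^ 2 < 1}

/-- The embedding `z ↦ (z,1)` of `ℂⁿ` into `ℂ^{n,1}`. -/
def emb {n : ℕ} (z : Fin n → ℂ) : Fin n ⊕ Unit → ℂ := Sum.elim z (fun _ => 1)

/-- The denominator `c·z + d`. -/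
def denom {n : ℕ} (g : SU n) (z : Fin n → ℂ) : ℂ := (mat g *ᵥ emb z) (Sum.inr ())

/-- The automorphy factor `j(g,z) = (c·z + d)⁻¹`. -/
def j {n : ℕ} (g : SU n) (z : Fin n → ℂ) : ℂ := (denom g z)⁻¹

/-- The action of `SU(n,1)` on the ball by fractional linear maps. -/
def act {n : ℕ} (g : SU n) (z : Fin n → ℂ) : Fin n → ℂ :=
  fun i => (mat g *ᵥ emb z) (Sum.inl i) / denom g z

/-- The invariant volume `dV = 4ⁿ dV_E / (1-|z|²)^{n+1}` on the ball, where `dV_E` is Lebesgue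
measure on `ℂⁿ`. -/
def hypVolume (n : ℕ) : Measure (Fin n → ℂ) :=
  (volume.restrict (ball n)).withDensity
    (fun z => ENNReal.ofReal (4 ^ n / (1 - ∑ i, ‖z i‖ ^ 2) ^ (n + 1)))

/-! ### Lattices, automorphic forms, Petersson product -/

/-- `Γ` is a lattice: it is discrete and `Γ \ SU(n,1)` has finite Haar measure. -/
structure IsLattice {n : ℕ} (Γ : Subgroup (SU n)) (μ : Measure (SU n)) : Prop where
  discrete : DiscreteTopology Γ
  finite_covolume : ∃ D : Set (SU n), IsFundamentalDomain Γ D μ ∧ μ D < ⊤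

/-- `(f|γ)(z) = f(γ z) j(γ,z)^{2m}`. -/
def slash {n : ℕ} (m : ℕ) (f : (Fin n → ℂ) → ℂ) (γ : SU n) (z : Fin n → ℂ) : ℂ :=
  f (act γ z) * j γ z ^ (2 * m)

/-- The lift `f̃(g) = f(g(0)) j(g,0)^{2m}` of `f` to `SU(n,1)`. -/
def lift {n : ℕ} (m : ℕ) (f : (Fin n → ℂ) → ℂ) (g : SU n) : ℂ :=
  f (act g 0) * j g 0 ^ (2 * m)

/-- Membership in the space `S_{2m}(Γ)` of (holomorphic) cusp forms of weight `2m`. -/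
structure IsCuspForm {n : ℕ} (Γ : Subgroup (SU n)) (m : ℕ) (f : (Fin n → ℂ) → ℂ) : Prop where
  holo : DifferentiableOn ℂ f (ball n)
  invariant : ∀ γ ∈ Γ, ∀ z ∈ ball n, slash m f γ z = f z
  bounded : ∃ M : ℝ, ∀ g : SU n, ‖lift m f g‖ ≤ M

/-- The integrand `f̃₁(g) · conj f̃₂(g)` of the Petersson product. -/
def peterssonIntegrand {n : ℕ} (m : ℕ) (f₁ f₂ : (Fin n → ℂ) → ℂ) (g : SU n) : ℂ :=
  lift m f₁ g * star (lift m f₂ g)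

/-- The Petersson product `(f₁,f₂) = ∫_{Γ \ SU(n,1)} f̃₁ conj(f̃₂) dg`, as an integral over a
fundamental domain `D` for `Γ` acting on `SU(n,1)` by left multiplication. -/
def petersson {n : ℕ} (μ : Measure (SU n)) (D : Set (SU n)) (m : ℕ)
    (f₁ f₂ : (Fin n → ℂ) → ℂ) : ℂ :=
  ∫ g in D, peterssonIntegrand m f₁ f₂ g ∂μ

/-! ### The frame flow and loxodromic elements -/

/-- The matrix of `a_t = exp tΔ`. -/
def flowMatrix (n : ℕ) [NeZero n] (t : ℝ) : Matrix (Fin n ⊕ Unit) (Fin n ⊕ Unit) ℂ :=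
  Matrix.fromBlocks
    (Matrix.diagonal (fun i => if i = ⊤ then (Real.cosh t : ℂ) else 1))
    (Matrix.of (fun i _ => if i = ⊤ then (Real.sinh t : ℂ) else 0))
    (Matrix.of (fun _ i => if i = ⊤ then (Real.sinh t : ℂ) else 0))
    (Matrix.of (fun _ _ => (Real.cosh t : ℂ)))

theorem flowMatrix_mul_self (n : ℕ) [NeZero n] (t : ℝ) :
    flowMatrix n t * flowMatrix n t = flowMatrix n (t + t) := by
  have h1 : (Real.cosh (t + t) : ℂ) =
      Real.cosh t * Real.cosh t + Real.sinh t * Real.sinh t := by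
    exact_mod_cast Real.cosh_add t t
  have h2 : (Real.sinh (t + t) : ℂ) =
      Real.sinh t * Real.cosh t + Real.cosh t * Real.sinh t := by
    exact_mod_cast Real.sinh_add t t
  simp only [flowMatrix, Matrix.fromBlocks_multiply, h1, h2]
  congr 1
  · ext i k
    by_cases hi : i = ⊤ <;> by_cases hk : k = ⊤ <;>
      simp [Matrix.mul_apply, Matrix.diagonal_apply, hi, hk]
    · simp [eq_comm, hk]
  · ext i k
    by_cases hi : i = ⊤ <;> simp [Matrix.mul_apply, Matrix.diagonal_apply, hi]
    ring
  · ext i k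
    by_cases hk : k = ⊤ <;> simp [Matrix.mul_apply, Matrix.diagonal_apply, hk]
  · ext i k
    simp [Matrix.mul_apply]
    ring

theorem preservesForm_flowMatrix (n : ℕ) [NeZero n] (t : ℝ) :
    PreservesForm (flowMatrix n t) := by
  have h : (Real.cosh t : ℂ) * Real.cosh t = 1 + Real.sinh t * Real.sinh t := by
    have := Real.cosh_sq t
    have h' : Real.cosh t * Real.cosh t = 1 + Real.sinh t * Real.sinh t := by nlinarith
    exact_mod_cast h'
  have hT : (flowMatrix n t)ᴴ = flowMatrix n t := by
    ext i k
    rcases i with i | i <;> rcases k with k | k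
    · by_cases hik : k = i
      · subst hik
        by_cases hi : k = ⊤ <;> simp [flowMatrix, hi, ← Complex.cosh_conj]
      · simp [flowMatrix, Matrix.diagonal_apply, hik, Ne.symm hik]
    · by_cases hi : i = ⊤ <;> simp [flowMatrix, hi, ← Complex.sinh_conj]
    · by_cases hi : k = ⊤ <;> simp [flowMatrix, hi, ← Complex.sinh_conj]
    · simp [flowMatrix, ← Complex.cosh_conj]
  unfold PreservesForm
  rw [hT]
  simp only [flowMatrix, formMatrix, Matrix.fromBlocks_multiply]
  congr 1
  · ext i k
    by_cases hi : i = ⊤ <;> by_cases hk : k = ⊤ <;>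
      simp [Matrix.mul_apply, Matrix.diagonal_apply, Matrix.one_apply, hi, hk]
    · have := h
      push_cast at this
      rw [this]; ring
    · simp [eq_comm, hk]
  · ext i k
    by_cases hi : i = ⊤ <;> simp [Matrix.mul_apply, Matrix.diagonal_apply, hi]
    ring
  · ext i k
    by_cases hk : k = ⊤ <;> simp [Matrix.mul_apply, Matrix.diagonal_apply, hk]
    ring
  · ext i k
    simp [Matrix.mul_apply]
    have := h
    push_cast at this
    rw [this]; ring

theorem det_flowMatrix (n : ℕ) [NeZero n] (t : ℝ) : (flowMatrix n t).det = 1 := by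
  have key : ∀ s : ℝ, (flowMatrix n s).det * star (flowMatrix n s).det = 1 := by
    intro s
    have h := congrArg Matrix.det (preservesForm_flowMatrix n s)
    rw [Matrix.det_mul, Matrix.det_mul, Matrix.det_conjTranspose] at h
    have hS : (formMatrix n).det ≠ 0 := by simp [formMatrix]
    apply mul_left_cancel₀ hS
    linear_combination h
  have hreal : ∀ s : ℝ, star (flowMatrix n s).det = (flowMatrix n s).det := by
    intro s
    rw [← Matrix.det_conjTranspose]
    congr 1
    ext i k
    rcases i with i | i <;> rcases k with k | k
    · by_cases hik : k = i
      · subst hik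
        by_cases hi : k = ⊤ <;> simp [flowMatrix, hi, ← Complex.cosh_conj]
      · simp [flowMatrix, Matrix.diagonal_apply, hik, Ne.symm hik]
    · by_cases hi : i = ⊤ <;> simp [flowMatrix, hi, ← Complex.sinh_conj]
    · by_cases hi : k = ⊤ <;> simp [flowMatrix, hi, ← Complex.sinh_conj]
    · simp [flowMatrix, ← Complex.cosh_conj]
  have h := flowMatrix_mul_self n (t / 2)
  rw [add_halves] at h
  rw [← h, Matrix.det_mul]
  have := key (t / 2)
  rwa [hreal] at this

/-- The one-parameter group `a_t` of `SU(n,1)`; the frame flow is `g ↦ g a_t`. -/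
def flow (n : ℕ) [NeZero n] (t : ℝ) : SU n :=
  ⟨⟨flowMatrix n t, det_flowMatrix n t⟩, preservesForm_flowMatrix n t⟩

/-- `w = diag(u, e^{-iψ}, e^{-iψ})` with `u ∈ U(n-1)`: a unitary matrix whose last two columns are
`e^{-iψ} eₙ` and `e^{-iψ} eₙ₊₁`. -/
structure IsRotation {n : ℕ} [NeZero n] (ψ : ℝ)
    (w : Matrix (Fin n ⊕ Unit) (Fin n ⊕ Unit) ℂ) : Prop where
  unitary : wᴴ * w = 1
  col_n : ∀ i, w i (Sum.inl ⊤) =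
    if i = Sum.inl ⊤ then Complex.exp (-(Complex.I * ψ)) else 0
  col_last : ∀ i, w i (Sum.inr ()) =
    if i = Sum.inr () then Complex.exp (-(Complex.I * ψ)) else 0

/-- The subgroup `W` of the maximal compact subgroup fixing the standard geodesic pointwise. -/
def W (n : ℕ) [NeZero n] : Set (SU n) := {w | ∃ ψ : ℝ, IsRotation ψ (mat w)}

/-- `γ` is loxodromic: conjugate in `SU(n,1)` to `a_t w` with `t ≠ 0` and `w ∈ W`. -/
def IsLoxodromic {n : ℕ} [NeZero n] (γ : SU n) : Prop :=
  ∃ (h : SU n) (t : ℝ), t ≠ 0 ∧ ∃ w ∈ W n, h⁻¹ * γ * h = flow n t * w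

/-- `X` is the attracting fixed point of `γ` on the boundary of the ball, represented by the null
vector with last coordinate `1`. -/
structure IsAttracting {n : ℕ} (γ : SU n) (X : Fin n ⊕ Unit → ℂ) : Prop where
  null : herm X X = 0
  last : X (Sum.inr ()) = 1
  eigen : ∃ lam : ℂ, 1 < ‖lam‖ ∧ mat γ *ᵥ X = lam • X

/-- `Y` is the repelling fixed point of `γ`, in the same normalization. -/
def IsRepelling {n : ℕ} (γ : SU n) (Y : Fin n ⊕ Unit → ℂ) : Prop := IsAttracting γ⁻¹ Y

/-- `q(z) = (⟨z,X⟩⟨z,Y⟩)^{-m}`. -/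
def qForm {n : ℕ} (X Y : Fin n ⊕ Unit → ℂ) (m : ℕ) (z : Fin n → ℂ) : ℂ :=
  ((herm (emb z) X * herm (emb z) Y) ^ m)⁻¹

/-- The coset space `⟨γ₀⟩ \ Γ`. -/
abbrev CyclicCosets {n : ℕ} {Γ : Subgroup (SU n)} (γ₀ : Γ) : Type :=
  Quotient (QuotientGroup.rightRel (Subgroup.zpowers γ₀))

/-- The term `q|γ` of the relative Poincaré series, for a representative `γ` of the coset. It does
not depend on the representative when `q|γ₀ = q`. -/
def thetaTerm {n : ℕ} {Γ : Subgroup (SU n)} (γ₀ : Γ) (X Y : Fin n ⊕ Unit → ℂ) (m : ℕ)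
    (z : Fin n → ℂ) (c : CyclicCosets γ₀) : ℂ :=
  slash m (qForm X Y m) (Quotient.out c : Γ) z

/-- The relative Poincaré series `Θ(z) = ∑_{γ ∈ ⟨γ₀⟩ \ Γ} (q|γ)(z)`. -/
def theta {n : ℕ} {Γ : Subgroup (SU n)} (γ₀ : Γ) (X Y : Fin n ⊕ Unit → ℂ) (m : ℕ)
    (z : Fin n → ℂ) : ℂ :=
  ∑' c : CyclicCosets γ₀, thetaTerm γ₀ X Y m z c

/-- The segment `{g a_t : 0 ≤ t ≤ s}` of an orbit of the frame flow is a lift of the closed geodesic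
of `γ`: the base points `g a_t(0)` run along the axis of `γ`, on which `γ` acts as the translation
`t ↦ t + s`, `s > 0`. -/
def IsGeodesicLift {n : ℕ} [NeZero n] (γ g : SU n) (s : ℝ) : Prop :=
  0 < s ∧ ∀ t : ℝ, act γ (act (g * flow n t) 0) = act (g * flow n (t + s)) 0

/-- `T ∈ U(n,1)` is a reference frame on the axis: its last two columns are `X/⟨X,Y⟩ + Y/2` and
`X/⟨X,Y⟩ - Y/2`. -/
structure IsReferenceFrame {n : ℕ} [NeZero n] (X Y : Fin n ⊕ Unit → ℂ)
    (T : Matrix (Fin n ⊕ Unit) (Fin n ⊕ Unit) ℂ) : Prop where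
  form : PreservesForm T
  col_n : ∀ i, T i (Sum.inl ⊤) = X i / herm X Y + Y i / 2
  col_last : ∀ i, T i (Sum.inr ()) = X i / herm X Y - Y i / 2

/-- `α = -⟨X,Y⟩/2`. -/
def alpha {n : ℕ} (X Y : Fin n ⊕ Unit → ℂ) : ℂ := -(herm X Y) / 2

/-- The constant `C = (2m-n-1)! / ((m-1)!)² · πⁿ · 2^{2(n+1)-2m-1}`, with `m = (n+1)κ`. -/
def periodConst (n m : ℕ) : ℝ :=
  ((2 * m - n - 1)! : ℝ) / ((m - 1)! : ℝ) ^ 2 * Real.pi ^ n *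
    (2 : ℝ) ^ (2 * ((n : ℤ) + 1) - 2 * (m : ℤ) - 1)

/-- The admissible `κ`: half-integers `κ ≥ 1` with `(n+1)κ` an integer. -/
def weightSet (n : ℕ) : Set ℚ :=
  {κ | 1 ≤ κ ∧ (∃ a : ℤ, κ = a / 2) ∧ ∃ b : ℤ, ((n : ℚ) + 1) * κ = b}

end ComplexHyperbolic

end

/-! The theorem combines a reproducing kernel on the group, one explicit integral along a geodesic,
and unfolding. Write `e` for the last basis vector.

Reproducing kernel: if `f` is holomorphic with bounded lift, then `∫ f̃(g) conj⟨g e, h e⟩^{-2m} dg`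
is a fixed constant times `f̃(h)`. Left invariance of Haar measure reduces this to `h = 1`. There
the integrand depends only on `z = g(0)`; it is `f(z)` times a radial weight, and the mean value
property replaces `f(z)` by `f(0)` (`integral_lift_mul_star_herm_pow_inv`).

Geodesic integral: `e` is the sum of two null eigenvectors `P`, `Q` of `a_t`, so `⟨v, h a_t e⟩ = e^t
A + e^{-t} B` with `A = ⟨v, hP⟩`, `B = ⟨v, hQ⟩`. The integral over `ℝ` of its power `-2m` is a
constant times `(AB)^{-m}` (`integral_expPair_pow_inv`). When `hP` and `hQ` are multiples of `X` and
`Y`, the lift of `q` is therefore an integral of reproducing kernels over the axis.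

Unfolding: `γ₀` shifts the parameter of the axis by `s`, up to a scalar whose power `2m` is `1`
because `q|γ₀ = q`. The integral over `ℝ` is thus the sum over `⟨γ₀⟩` of integrals over one period,
and the sum over `⟨γ₀⟩ \ Γ` becomes a sum over `Γ`. The Petersson product turns into an integral
over the whole group, and Fubini with the reproducing property leaves a constant times `∫_0^s f̃(h
a_t) dt` (`petersson_theta_of_translatesGeodesic`).

The same unfolding gives convergence of the series at almost every point of `D`; a Harnack
inequality spreads it from one point to the ball. Finally, the endpoints of a geodesic lift are `X`
and `Y`, and comparing scalars with the frame `T` produces `r`, `ψ` and the factor `e^{-2miψ}`. -/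

namespace ComplexHyperbolic

/-! ### The Hermitian form and the action on the ball -/

section Form

variable {n : ℕ}

theorem herm_add_left (z z' w : Fin n ⊕ Unit → ℂ) : herm (z + z') w = herm z w + herm z' w := by
  simp only [herm, Pi.add_apply, add_mul, Finset.sum_add_distrib]; ring

theorem herm_smul_left (a : ℂ) (z w : Fin n ⊕ Unit → ℂ) : herm (a • z) w = a * herm z w := by
  simp only [herm, Pi.smul_apply, smul_eq_mul, mul_sub, Finset.mul_sum, mul_assoc]

theorem star_herm (z w : Fin n ⊕ Unit → ℂ) : star (herm z w) = herm w z := by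
  simp only [herm, star_sub, star_sum, star_mul', star_star, mul_comm]

theorem herm_add_right (z w w' : Fin n ⊕ Unit → ℂ) : herm z (w + w') = herm z w + herm z w' := by
  rw [← star_herm, herm_add_left, star_add, star_herm, star_herm]

theorem herm_smul_right (a : ℂ) (z w : Fin n ⊕ Unit → ℂ) :
    herm z (a • w) = star a * herm z w := by
  rw [← star_herm, herm_smul_left, star_mul', star_herm]

theorem herm_self (z : Fin n ⊕ Unit → ℂ) :
    herm z z = ((∑ i, ‖z (Sum.inl i)‖ ^ 2 - ‖z (Sum.inr ())‖ ^ 2 : ℝ) : ℂ) := by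
  simp only [herm, Complex.star_def, Complex.mul_conj, Complex.normSq_eq_norm_sq]
  push_cast
  rfl

theorem herm_eq_dotProduct (z w : Fin n ⊕ Unit → ℂ) :
    herm z w = star w ⬝ᵥ (formMatrix n *ᵥ z) := by
  simp [herm, formMatrix, dotProduct, Matrix.fromBlocks_mulVec, Matrix.neg_mulVec, sub_eq_add_neg,
    mul_comm]

theorem herm_mulVec {A : Matrix (Fin n ⊕ Unit) (Fin n ⊕ Unit) ℂ} (hA : PreservesForm A)
    (z w : Fin n ⊕ Unit → ℂ) : herm (A *ᵥ z) (A *ᵥ w) = herm z w := by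
  rw [herm_eq_dotProduct, herm_eq_dotProduct, star_mulVec, ← dotProduct_mulVec, mulVec_mulVec,
    mulVec_mulVec, show Aᴴ * formMatrix n * A = formMatrix n from hA]

theorem preservesForm_mat (g : SU n) : PreservesForm (mat g) := g.2

theorem mat_mul (g h : SU n) : mat (g * h) = mat g * mat h := rfl

theorem mat_one : mat (1 : SU n) = 1 := rfl

theorem mat_inv_mulVec_mat_mulVec (g : SU n) (v : Fin n ⊕ Unit → ℂ) :
    mat g⁻¹ *ᵥ (mat g *ᵥ v) = v := by
  rw [mulVec_mulVec, ← mat_mul, inv_mul_cancel, mat_one, one_mulVec]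

theorem mat_mulVec_mat_inv_mulVec (g : SU n) (v : Fin n ⊕ Unit → ℂ) :
    mat g *ᵥ (mat g⁻¹ *ᵥ v) = v := by
  rw [mulVec_mulVec, ← mat_mul, mul_inv_cancel, mat_one, one_mulVec]

theorem herm_mat_mulVec (g : SU n) (z w : Fin n ⊕ Unit → ℂ) :
    herm (mat g *ᵥ z) w = herm z (mat g⁻¹ *ᵥ w) := by
  rw [← herm_mulVec (preservesForm_mat g) z, mat_mulVec_mat_inv_mulVec]

theorem herm_emb_self (z : Fin n → ℂ) :
    herm (emb z) (emb z) = ((∑ i, ‖z i‖ ^ 2 - 1 : ℝ) : ℂ) := by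
  simp [herm_self, emb]

theorem emb_zero : (emb 0 : Fin n ⊕ Unit → ℂ) = Pi.single (Sum.inr ()) 1 := by
  ext (i | i) <;> simp [emb]

theorem herm_emb_zero_right (v : Fin n ⊕ Unit → ℂ) :
    herm v (emb 0) = -v (Sum.inr ()) := by
  simp [herm, emb]

theorem zero_mem_ball : (0 : Fin n → ℂ) ∈ ball n := by simp [ball]

/-- The image of `(z,1)` is a negative vector, whereas a vector with last coordinate `0` has
nonnegative form. -/
theorem denom_ne_zero (g : SU n) {z : Fin n → ℂ} (hz : z ∈ ball n) : denom g z ≠ 0 := by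
  intro h
  have h1 := herm_mulVec (preservesForm_mat g) (emb z) (emb z)
  rw [herm_emb_self, herm_self, Complex.ofReal_inj, show (mat g *ᵥ emb z) (Sum.inr ()) = 0 from h,
    norm_zero] at h1
  have h2 : ∑ i, ‖z i‖ ^ 2 < 1 := hz
  have h3 : 0 ≤ ∑ i, ‖(mat g *ᵥ emb z) (Sum.inl i)‖ ^ 2 := by positivity
  linarith

theorem mat_mulVec_emb (g : SU n) {z : Fin n → ℂ} (hz : z ∈ ball n) :
    mat g *ᵥ emb z = denom g z • emb (act g z) := by
  ext (i | i)
  · simp [emb, act, mul_div_cancel₀ _ (denom_ne_zero g hz)]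
  · simp [emb, denom]

theorem one_sub_normSq_act (g : SU n) {z : Fin n → ℂ} (hz : z ∈ ball n) :
    1 - ∑ i, ‖act g z i‖ ^ 2 = (1 - ∑ i, ‖z i‖ ^ 2) * ‖j g z‖ ^ 2 := by
  have h1 := herm_mulVec (preservesForm_mat g) (emb z) (emb z)
  rw [mat_mulVec_emb g hz, herm_smul_left, herm_smul_right, herm_emb_self, herm_emb_self,
    ← mul_assoc, Complex.star_def, Complex.mul_conj, Complex.normSq_eq_norm_sq] at h1
  norm_cast at h1
  have h2 := norm_ne_zero_iff.2 (denom_ne_zero g hz)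
  rw [j, norm_inv]
  field_simp
  linarith

theorem act_mem_ball (g : SU n) {z : Fin n → ℂ} (hz : z ∈ ball n) : act g z ∈ ball n := by
  have h1 := one_sub_normSq_act g hz
  have h2 : ∑ i, ‖z i‖ ^ 2 < 1 := hz
  have h3 : j g z ≠ 0 := inv_ne_zero (denom_ne_zero g hz)
  have h4 : 0 < (1 - ∑ i, ‖z i‖ ^ 2) * ‖j g z‖ ^ 2 :=
    mul_pos (by linarith) (by positivity)
  change ∑ i, ‖act g z i‖ ^ 2 < 1
  linarith

theorem norm_j_zero_sq (g : SU n) : ‖j g 0‖ ^ 2 = 1 - ∑ i, ‖act g 0 i‖ ^ 2 := by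
  simp [one_sub_normSq_act g zero_mem_ball]

theorem denom_mul (g h : SU n) {z : Fin n → ℂ} (hz : z ∈ ball n) :
    denom (g * h) z = denom h z * denom g (act h z) := by
  rw [denom, mat_mul, ← mulVec_mulVec, mat_mulVec_emb h hz, mulVec_smul]
  rfl

theorem act_mul (g h : SU n) {z : Fin n → ℂ} (hz : z ∈ ball n) :
    act (g * h) z = act g (act h z) := by
  ext i
  rw [act, denom_mul g h hz, mat_mul, ← mulVec_mulVec, mat_mulVec_emb h hz, mulVec_smul,
    Pi.smul_apply, smul_eq_mul, mul_div_mul_left _ _ (denom_ne_zero h hz)]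
  rfl

theorem j_mul (g h : SU n) {z : Fin n → ℂ} (hz : z ∈ ball n) :
    j (g * h) z = j h z * j g (act h z) := by
  rw [j, denom_mul g h hz, mul_inv]; rfl

/-- This is the cocycle rule for `j`. It lets statements about lifts at the identity be moved to any
group element by replacing `f` with `f|g`. -/
theorem lift_mul (m : ℕ) (f : (Fin n → ℂ) → ℂ) (g h : SU n) :
    lift m f (g * h) = lift m (slash m f g) h := by
  simp only [lift, slash, act_mul g h zero_mem_ball, j_mul g h zero_mem_ball, mul_pow]
  ring

theorem lift_one (m : ℕ) (f : (Fin n → ℂ) → ℂ) : lift m f 1 = f 0 := by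
  have : denom (1 : SU n) 0 = 1 := by simp [denom, mat_one, emb]
  have h2 : act (1 : SU n) 0 = 0 := by ext i; simp [act, mat_one, emb]
  simp [lift, j, this, h2]

theorem IsCuspForm.lift_mul_left {Γ : Subgroup (SU n)} {m : ℕ} {f : (Fin n → ℂ) → ℂ}
    (hf : IsCuspForm Γ m f) {γ : SU n} (hγ : γ ∈ Γ) (g : SU n) :
    lift m f (γ * g) = lift m f g := by
  rw [lift_mul, lift, lift, hf.invariant γ hγ _ (act_mem_ball g zero_mem_ball)]

theorem herm_mat_mulVec_emb_zero (g h : SU n) :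
    herm (mat g *ᵥ emb 0) (mat h *ᵥ emb 0) = -denom (h⁻¹ * g) 0 := by
  rw [← inv_inv h, ← herm_mat_mulVec, inv_inv, herm_emb_zero_right, mulVec_mulVec, ← mat_mul]
  rfl

/-- As a function of vectors, `q` is homogeneous of degree `-2m`, and `j^{2m}` exactly undoes the
normalization of the last coordinate. -/
theorem slash_qForm (X Y : Fin n ⊕ Unit → ℂ) (m : ℕ) (g : SU n) {z : Fin n → ℂ}
    (hz : z ∈ ball n) :
    slash m (qForm X Y m) g z =
      ((herm (mat g *ᵥ emb z) X * herm (mat g *ᵥ emb z) Y) ^ m)⁻¹ := by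
  rw [slash, qForm, mat_mulVec_emb g hz, herm_smul_left, herm_smul_left, j, inv_pow, ← mul_inv,
    pow_mul, ← mul_pow]
  congr 2
  ring

theorem lift_qForm (X Y : Fin n ⊕ Unit → ℂ) (m : ℕ) (g : SU n) :
    lift m (qForm X Y m) g =
      ((herm (mat g *ᵥ emb 0) X * herm (mat g *ᵥ emb 0) Y) ^ m)⁻¹ :=
  slash_qForm X Y m g zero_mem_ball

end Form

/-! ### The standard geodesic -/

section Flow

variable {n : ℕ} [NeZero n]

/-- The attracting null vector `(eₙ + eₙ₊₁) / 2` of the flow. -/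
noncomputable def nullPlus (n : ℕ) [NeZero n] : Fin n ⊕ Unit → ℂ :=
  Sum.elim (fun i => if i = ⊤ then 1 / 2 else 0) (fun _ => 1 / 2)

/-- The repelling null vector `(-eₙ + eₙ₊₁) / 2` of the flow. -/
noncomputable def nullMinus (n : ℕ) [NeZero n] : Fin n ⊕ Unit → ℂ :=
  Sum.elim (fun i => if i = ⊤ then -(1 / 2) else 0) (fun _ => 1 / 2)

theorem nullPlus_add_nullMinus : nullPlus n + nullMinus n = emb 0 := by
  ext (i | i)
  · by_cases hi : i = ⊤ <;> simp [nullPlus, nullMinus, emb, hi]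
  · simp [nullPlus, nullMinus, emb]; norm_num

theorem nullPlus_sub_nullMinus : nullPlus n - nullMinus n = Pi.single (Sum.inl ⊤) 1 := by
  ext (i | i)
  · by_cases hi : i = ⊤
    · subst hi; simp [nullPlus, nullMinus]; norm_num
    · simp [nullPlus, nullMinus, hi]
  · simp [nullPlus, nullMinus]

theorem herm_nullPlus_right (v : Fin n ⊕ Unit → ℂ) :
    herm v (nullPlus n) = (v (Sum.inl ⊤) - v (Sum.inr ())) / 2 := by
  simp [herm, nullPlus, apply_ite (star : ℂ → ℂ)]; ring

theorem herm_nullMinus_right (v : Fin n ⊕ Unit → ℂ) :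
    herm v (nullMinus n) = -(v (Sum.inl ⊤) + v (Sum.inr ())) / 2 := by
  simp [herm, nullMinus, apply_ite (star : ℂ → ℂ)]; ring

theorem flowMatrix_mulVec_nullPlus (t : ℝ) :
    flowMatrix n t *ᵥ nullPlus n = Complex.exp t • nullPlus n := by
  ext (i | i)
  · by_cases hi : i = ⊤ <;>
      simp [flowMatrix, nullPlus, hi, Matrix.mulVec, dotProduct, Matrix.diagonal_apply]
    rw [← Complex.cosh_add_sinh]
    ring
  · simp [flowMatrix, nullPlus, Matrix.mulVec, dotProduct]
    rw [← Complex.cosh_add_sinh]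
    ring

theorem flowMatrix_mulVec_nullMinus (t : ℝ) :
    flowMatrix n t *ᵥ nullMinus n = Complex.exp (-t) • nullMinus n := by
  ext (i | i)
  · by_cases hi : i = ⊤ <;>
      simp [flowMatrix, nullMinus, hi, Matrix.mulVec, dotProduct, Matrix.diagonal_apply]
    rw [← Complex.cosh_sub_sinh]
    ring
  · simp [flowMatrix, nullMinus, Matrix.mulVec, dotProduct]
    rw [← Complex.cosh_sub_sinh]
    ring

theorem mat_flow (t : ℝ) : mat (flow n t) = flowMatrix n t := rfl

/-- The base vector splits into the expanding and contracting eigenvectors of the flow; all later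
computations along geodesics use only this exponential sum. -/
theorem mat_mul_flow_mulVec (g : SU n) (t : ℝ) :
    mat (g * flow n t) *ᵥ emb 0 =
      Complex.exp t • (mat g *ᵥ nullPlus n) + Complex.exp (-t) • (mat g *ᵥ nullMinus n) := by
  rw [mat_mul, ← mulVec_mulVec, ← nullPlus_add_nullMinus, mulVec_add, mat_flow,
    flowMatrix_mulVec_nullPlus, flowMatrix_mulVec_nullMinus, mulVec_add, mulVec_smul, mulVec_smul]

end Flow

/-! ### Integrals of negative powers along a geodesic -/

section GeodesicIntegral

open Filter Asymptotics

/-- The exponential sum `e^t A + e^{-t} B`. -/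
noncomputable def expPair (A B : ℂ) (t : ℝ) : ℂ := Complex.exp t * A + Complex.exp (-t) * B

theorem expPair_neg (A B : ℂ) (t : ℝ) : expPair A B (-t) = expPair B A t := by
  simp [expPair, add_comm]

theorem continuous_expPair (A B : ℂ) : Continuous (expPair A B) := by
  unfold expPair; fun_prop

theorem hasDerivAt_expPair (A B : ℂ) (t : ℝ) :
    HasDerivAt (expPair A B) (expPair A (-B) t) t := by
  have h1 := ((Complex.hasDerivAt_exp (t : ℂ)).mul_const A)
  have h2 := (((Complex.hasDerivAt_exp (-(t : ℂ))).comp (t : ℂ) (hasDerivAt_neg _)).mul_const B)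
  refine ((h1.add h2).comp_ofReal).congr_deriv ?_
  simp [expPair]

theorem tendsto_exp_neg_atTop_zero :
    Tendsto (fun t : ℝ => Complex.exp (-t)) atTop (nhds 0) := by
  have : Tendsto (fun t : ℝ => Real.exp (-t)) atTop (nhds 0) :=
    Real.tendsto_exp_neg_atTop_nhds_zero
  exact_mod_cast (Complex.continuous_ofReal.tendsto 0).comp this

theorem tendsto_exp_mul_expPair_inv {A : ℂ} (B : ℂ) (hA : A ≠ 0) :
    Tendsto (fun t : ℝ => Complex.exp t * (expPair A B t)⁻¹) atTop (nhds A⁻¹) := by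
  have h1 : Tendsto (fun t : ℝ => A + Complex.exp (-t) * Complex.exp (-t) * B) atTop
      (nhds (A + 0 * 0 * B)) :=
    tendsto_const_nhds.add
      ((tendsto_exp_neg_atTop_zero.mul tendsto_exp_neg_atTop_zero).mul_const _)
  rw [zero_mul, zero_mul, add_zero] at h1
  refine (h1.inv₀ hA).congr fun t => ?_
  have : expPair A B t = Complex.exp t * (A + Complex.exp (-t) * Complex.exp (-t) * B) := by
    have h : Complex.exp t * Complex.exp (-t) = 1 := by rw [← Complex.exp_add]; simp
    rw [expPair]
    linear_combination (-Complex.exp (-t) * B) * h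
  rw [this, mul_inv, ← mul_assoc, mul_inv_cancel₀ (Complex.exp_ne_zero _), one_mul]

theorem isBigO_expPair_inv_atTop {A : ℂ} (B : ℂ) (hA : A ≠ 0) :
    (fun t : ℝ => (expPair A B t)⁻¹) =O[atTop] fun t : ℝ => Real.exp (-t) := by
  have h2 := ((tendsto_exp_mul_expPair_inv B hA).isBigO_one ℂ).mul
    (isBigO_refl (fun t : ℝ => Complex.exp (-t)) atTop)
  refine (h2.congr_left fun t => ?_).trans ?_
  · have h : Complex.exp t * Complex.exp (-t) = 1 := by rw [← Complex.exp_add]; simp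
    linear_combination ((expPair A B t)⁻¹) * h
  · refine isBigO_of_le _ fun t => ?_
    rw [one_mul, Complex.norm_exp]
    simp

theorem tendsto_expPair_inv_atTop {A : ℂ} (B : ℂ) (hA : A ≠ 0) :
    Tendsto (fun t : ℝ => (expPair A B t)⁻¹) atTop (nhds 0) :=
  (isBigO_expPair_inv_atTop B hA).trans_tendsto Real.tendsto_exp_neg_atTop_nhds_zero

theorem isBigO_expPair_pow_inv_atTop {A : ℂ} (B : ℂ) (hA : A ≠ 0) (k : ℕ) :
    (fun t : ℝ => (expPair A B t ^ (k + 1))⁻¹) =O[atTop] fun t : ℝ => Real.exp (-t) := by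
  have h := (((tendsto_expPair_inv_atTop B hA).isBigO_one ℝ).pow k).mul
    (isBigO_expPair_inv_atTop B hA)
  refine (h.congr (fun t => ?_) fun t => ?_)
  · rw [← pow_succ, inv_pow]
  · simp

theorem integrable_expPair_pow_inv {A B : ℂ} (hA : A ≠ 0) (hB : B ≠ 0)
    (hD : ∀ t, expPair A B t ≠ 0) (k : ℕ) :
    Integrable fun t : ℝ => (expPair A B t ^ (k + 1))⁻¹ := by
  have hc : Continuous fun t : ℝ => (expPair A B t ^ (k + 1))⁻¹ :=
    ((continuous_expPair A B).pow _).inv₀ fun t => pow_ne_zero _ (hD t)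
  have hbot : (fun t : ℝ => (expPair A B t ^ (k + 1))⁻¹) =O[atBot] Real.exp := by
    refine ((isBigO_expPair_pow_inv_atTop A hB k).comp_tendsto tendsto_neg_atBot_atTop).congr
      (fun t => ?_) fun t => ?_
    · simp [expPair_neg]
    · simp
  refine hc.locallyIntegrable.integrable_of_isBigO_atBot_atTop hbot ?_
    (isBigO_expPair_pow_inv_atTop B hA k) ?_
  · exact ⟨Set.Iic 0, Iic_mem_atBot 0, integrableOn_exp_Iic 0⟩
  · exact ⟨Set.Ioi 0, Ioi_mem_atTop 0, by simpa using exp_neg_integrableOn_Ioi 0 one_pos⟩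

/-- With `D = e^t A + e^{-t} B`, an antiderivative of `2B/D²` is `e^t/D`, which tends to `1/A` at
`+∞` and to `0` at `-∞`. -/
theorem integral_expPair_sq_inv {A B : ℂ} (hA : A ≠ 0) (hB : B ≠ 0)
    (hD : ∀ t, expPair A B t ≠ 0) :
    ∫ t : ℝ, (expPair A B t ^ 2)⁻¹ = (A * B)⁻¹ / 2 := by
  have hd : ∀ t : ℝ, HasDerivAt (fun t : ℝ => Complex.exp t * (expPair A B t)⁻¹)
      (2 * B * (expPair A B t ^ 2)⁻¹) t := by
    intro t
    have h1 := (Complex.hasDerivAt_exp (t : ℂ)).comp_ofReal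
    refine (h1.mul ((hasDerivAt_expPair A B t).inv (hD t))).congr_deriv ?_
    have h : Complex.exp t * Complex.exp (-t) = 1 := by rw [← Complex.exp_add]; simp
    have h0 := hD t
    simp only [Pi.inv_apply]
    field_simp
    simp only [expPair]
    linear_combination (2 * B) * h
  have hbot : Tendsto (fun t : ℝ => Complex.exp t * (expPair A B t)⁻¹) atBot (nhds 0) := by
    have := (tendsto_exp_neg_atTop_zero.mul (tendsto_expPair_inv_atTop A hB)).comp
      tendsto_neg_atBot_atTop
    rw [zero_mul] at this
    refine this.congr fun t => ?_
    simp [expPair_neg]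
  have key := integral_of_hasDerivAt_of_tendsto hd
    ((integrable_expPair_pow_inv hA hB hD 1).const_mul _) hbot (tendsto_exp_mul_expPair_inv B hA)
  rw [integral_const_mul, sub_zero] at key
  field_simp at key ⊢
  linear_combination key

theorem tendsto_expPair_mul_pow_inv_atTop {A : ℂ} (B : ℂ) (hA : A ≠ 0)
    (hD : ∀ t, expPair A B t ≠ 0) (k : ℕ) :
    Tendsto (fun t : ℝ => expPair A (-B) t * (expPair A B t ^ (k + 2))⁻¹) atTop (nhds 0) := by
  have h1 := tendsto_expPair_inv_atTop B hA
  have h2 := ((((tendsto_exp_neg_atTop_zero.const_mul (-2 * B)).mul h1).const_add 1)).mul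
    (h1.pow (k + 1))
  simp only [ne_eq, Nat.add_eq_zero_iff, one_ne_zero, and_false, not_false_eq_true, zero_pow,
    mul_zero] at h2
  refine h2.congr fun t => ?_
  have : expPair A (-B) t = expPair A B t - 2 * B * Complex.exp (-t) := by
    simp only [expPair]; ring
  rw [this, pow_succ _ (k + 1), inv_pow, mul_inv]
  have h0 := mul_inv_cancel₀ (hD t)
  linear_combination (-(expPair A B t ^ (k + 1))⁻¹) * h0

/-- Differentiating `D'/D^{2k+3}` and using `D'² = D² - 4AB` gives a recursion between consecutive
even powers. The argument works for complex `A`, `B` without choosing a branch, since `D` never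
vanishes. -/
theorem integral_expPair_pow_inv {A B : ℂ} (hA : A ≠ 0) (hB : B ≠ 0)
    (hD : ∀ t, expPair A B t ≠ 0) (k : ℕ) :
    ∫ t : ℝ, (expPair A B t ^ (2 * (k + 1)))⁻¹ =
      ((A * B) ^ (k + 1))⁻¹ * ((k ! : ℂ) ^ 2 / (2 * (2 * k + 1)!)) := by
  induction k with
  | zero => simp [integral_expPair_sq_inv hA hB hD]; ring
  | succ k ih =>
    have hd : ∀ t : ℝ, HasDerivAt
        (fun t : ℝ => expPair A (-B) t * (expPair A B t ^ (2 * k + 1 + 2))⁻¹)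
        (4 * A * B * (2 * k + 3) * (expPair A B t ^ (2 * (k + 1 + 1)))⁻¹ -
          (2 * k + 2) * (expPair A B t ^ (2 * (k + 1)))⁻¹) t := by
      intro t
      have h1 := hasDerivAt_expPair A (-B) t
      have h2 := ((hasDerivAt_expPair A B t).pow (2 * k + 1 + 2)).inv (pow_ne_zero _ (hD t))
      refine (h1.mul h2).congr_deriv ?_
      have h : Complex.exp t * Complex.exp (-t) = 1 := by rw [← Complex.exp_add]; simp
      have hE : expPair A (-B) t ^ 2 = expPair A B t ^ 2 - 4 * A * B := by
        simp only [expPair]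
        linear_combination (-4 * A * B) * h
      have h0 := hD t
      simp only [Pi.inv_apply, Pi.pow_apply, neg_neg]
      have e1 : expPair A B t ^ (2 * k + 1 + 2) = expPair A B t ^ (2 * k) * expPair A B t ^ 3 := by
        ring
      have e2 : expPair A B t ^ (2 * k + 1 + 2 - 1) =
        expPair A B t ^ (2 * k) * expPair A B t ^ 2 := by
        rw [← pow_add]; rfl
      have e3 : expPair A B t ^ (2 * (k + 1 + 1)) =
        expPair A B t ^ (2 * k) * expPair A B t ^ 4 := by ring
      have e4 : expPair A B t ^ (2 * (k + 1)) =
        expPair A B t ^ (2 * k) * expPair A B t ^ 2 := by ring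
      rw [e1, e2, e3, e4]
      have h00 := pow_ne_zero (2 * k) h0
      generalize expPair A B t ^ (2 * k) = p at *
      generalize expPair A B t = d at *
      generalize expPair A (-B) t = e at *
      push_cast
      field_simp
      linear_combination (-(2 * (k : ℂ) + 1 + 2)) * hE
    have hbot : Tendsto (fun t : ℝ => expPair A (-B) t * (expPair A B t ^ (2 * k + 1 + 2))⁻¹)
        atBot (nhds 0) := by
      have hD' : ∀ t, expPair B A t ≠ 0 := fun t => by rw [← expPair_neg]; exact hD _
      have := ((tendsto_expPair_mul_pow_inv_atTop A hB hD' (2 * k + 1)).neg).comp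
        tendsto_neg_atBot_atTop
      rw [neg_zero] at this
      refine this.congr fun t => ?_
      simp only [Function.comp, expPair_neg, neg_mul_eq_neg_mul]
      congr 1
      simp only [expPair]
      ring
    have i1 : Integrable fun t : ℝ => (expPair A B t ^ (2 * (k + 1)))⁻¹ :=
      integrable_expPair_pow_inv hA hB hD (2 * k + 1)
    have i2 : Integrable fun t : ℝ => (expPair A B t ^ (2 * (k + 1 + 1)))⁻¹ :=
      integrable_expPair_pow_inv hA hB hD (2 * (k + 1) + 1)
    have key := integral_of_hasDerivAt_of_tendsto hd
      ((i2.const_mul _).sub (i1.const_mul _)) hbot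
      (tendsto_expPair_mul_pow_inv_atTop B hA hD (2 * k + 1))
    rw [integral_sub (i2.const_mul _) (i1.const_mul _), integral_const_mul, integral_const_mul,
      sub_zero] at key
    have e : ((2 * (k + 1) + 1)! : ℂ) = (2 * k + 3) * ((2 * k + 2) * (2 * k + 1)!) := by
      rw [show 2 * (k + 1) + 1 = (2 * k + 1) + 1 + 1 by ring, Nat.factorial_succ,
        Nat.factorial_succ]
      push_cast; ring
    have hk : ((2 * k + 1)! : ℂ) ≠ 0 := by exact_mod_cast Nat.factorial_ne_zero _
    have h3 : (2 * k + 3 : ℂ) ≠ 0 := by exact_mod_cast (by omega : 2 * k + 3 ≠ 0)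
    have h2 : (2 * k + 2 : ℂ) ≠ 0 := by exact_mod_cast (by omega : 2 * k + 2 ≠ 0)
    have i1' : ∫ t : ℝ, (expPair A B t ^ (2 * (k + 1)))⁻¹ =
      ((A * B) ^ (k + 1))⁻¹ * ((k ! : ℂ) ^ 2 / (2 * (2 * k + 1)!)) := ih
    have hfin : ∫ t : ℝ, (expPair A B t ^ (2 * (k + 1 + 1)))⁻¹ =
        (2 * k + 2) * (∫ t : ℝ, (expPair A B t ^ (2 * (k + 1)))⁻¹) /
          (4 * A * B * (2 * k + 3)) := by
      rw [eq_div_iff (mul_ne_zero (mul_ne_zero (mul_ne_zero (by norm_num) hA) hB) h3)]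
      linear_combination key
    rw [hfin, i1', e, Nat.factorial_succ k]
    push_cast
    have hAB : (A * B) ≠ 0 := mul_ne_zero hA hB
    field_simp
    ring

end GeodesicIntegral
/-! ### Integrals over the unit ball -/

section BallIntegral

theorem integral_pow_mul_one_sub_pow (a b : ℕ) :
    ∫ t in (0 : ℝ)..1, t ^ a * (1 - t) ^ b = (a ! * b ! : ℝ) / (a + b + 1)! := by
  have h := Complex.Gamma_mul_Gamma_eq_betaIntegral (s := a + 1) (t := b + 1)
    (by simp; positivity) (by simp; positivity)
  rw [Complex.Gamma_nat_eq_factorial, Complex.Gamma_nat_eq_factorial,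
    show (a + 1 + (b + 1) : ℂ) = ((a + b + 1 : ℕ) : ℂ) + 1 by push_cast; ring,
    Complex.Gamma_nat_eq_factorial, Complex.betaIntegral] at h
  have h1 : ∫ x : ℝ in (0 : ℝ)..1, (x : ℂ) ^ ((a : ℂ) + 1 - 1) * (1 - x : ℂ) ^ ((b : ℂ) + 1 - 1) =
      ((∫ t in (0 : ℝ)..1, t ^ a * (1 - t) ^ b : ℝ) : ℂ) := by
    rw [← intervalIntegral.integral_ofReal]
    congr 1
    ext x
    simp only [add_sub_cancel_right, Complex.cpow_natCast]
    push_cast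
    rfl
  rw [h1] at h
  have h2 : ((a + b + 1)! : ℝ) ≠ 0 := by positivity
  rw [eq_div_iff h2]
  have h' : (a ! * b ! : ℝ) = (a + b + 1)! * ∫ t in (0 : ℝ)..1, t ^ a * (1 - t) ^ b := by
    exact_mod_cast h
  linarith

variable {n : ℕ}

theorem continuous_normSq : Continuous fun z : Fin n → ℂ => ∑ i, ‖z i‖ ^ 2 := by fun_prop

theorem isOpen_ball : IsOpen (ball n) := isOpen_lt continuous_normSq continuous_const

theorem volume_normSq_lt [NeZero n] (c : ℝ) :
    volume {z : Fin n → ℂ | ∑ i, ‖z i‖ ^ 2 < c} =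
      ENNReal.ofReal c ^ n * ENNReal.ofReal (Real.pi ^ n / n !) := by
  rcases le_or_gt c 0 with hc | hc
  · have : {z : Fin n → ℂ | ∑ i, ‖z i‖ ^ 2 < c} = ∅ := by
      ext z
      have : 0 ≤ ∑ i, ‖z i‖ ^ 2 := by positivity
      simp; linarith
    rw [this, ENNReal.ofReal_of_nonpos hc]
    -- For `n = 0` the right side would be `0^0 = 1`, not the measure of the empty set.
    simp [NeZero.ne n]
  · have := Complex.volume_sum_rpow_lt (Fin n) (p := 2) (by norm_num) (Real.sqrt c)
    have e : {x : Fin n → ℂ | (∑ i, ‖x i‖ ^ (2 : ℝ)) ^ (1 / (2 : ℝ)) < Real.sqrt c} =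
        {z : Fin n → ℂ | ∑ i, ‖z i‖ ^ 2 < c} := by
      ext z
      simp only [Set.mem_ofPred_eq, ← Real.sqrt_eq_rpow, Real.rpow_two]
      exact Real.sqrt_lt_sqrt_iff (by positivity)
    rw [e] at this
    rw [this, pow_mul, ← ENNReal.ofReal_pow (Real.sqrt_nonneg _), Real.sq_sqrt hc.le]
    congr 2
    · simp
    · simp only [Fintype.card_fin]
      rw [show (2 : ℝ) / 2 + 1 = ((1 : ℕ) : ℝ) + 1 by norm_num, Real.Gamma_nat_eq_factorial,
        show (2 : ℝ) * n / 2 + 1 = (n : ℝ) + 1 by ring, Real.Gamma_nat_eq_factorial]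
      simp

/-- By the layer cake formula this is `(k+1) ∫ t^k vol{|z|² < 1-t} dt`; the volume is `(1-t)^n
π^n/n!`, which leaves a Beta integral. -/
theorem lintegral_ball_one_sub_normSq_pow [NeZero n] (k : ℕ) :
    ∫⁻ z in ball n, ENNReal.ofReal ((1 - ∑ i, ‖z i‖ ^ 2) ^ (k + 1)) =
      ENNReal.ofReal (Real.pi ^ n * (k + 1)! / (n + k + 1)!) := by
  have hnn : 0 ≤ᵐ[volume.restrict (ball n)] fun z : Fin n → ℂ => 1 - ∑ i, ‖z i‖ ^ 2 := by
    filter_upwards [ae_restrict_mem isOpen_ball.measurableSet] with z hz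
    exact sub_nonneg.2 (le_of_lt hz)
  have hm : AEMeasurable (fun z : Fin n → ℂ => 1 - ∑ i, ‖z i‖ ^ 2) (volume.restrict (ball n)) :=
    (continuous_const.sub continuous_normSq).aemeasurable
  have key := lintegral_rpow_eq_lintegral_meas_lt_mul _ hnn hm
    (p := ((k + 1 : ℕ) : ℝ)) (by positivity)
  simp only [Real.rpow_natCast] at key
  rw [key]
  have hset : ∀ t ∈ Set.Ioi (0 : ℝ),
      (volume.restrict (ball n)) {z : Fin n → ℂ | t < 1 - ∑ i, ‖z i‖ ^ 2} *
        ENNReal.ofReal (t ^ (((k + 1 : ℕ) : ℝ) - 1)) =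
      ENNReal.ofReal (Real.pi ^ n / n !) *
        (Set.Ioc (0 : ℝ) 1).indicator (fun t => ENNReal.ofReal (t ^ k * (1 - t) ^ n)) t := by
    intro t ht
    have ht0 : 0 < t := ht
    rw [Measure.restrict_apply (isOpen_lt (by fun_prop) (by fun_prop)).measurableSet]
    have e : {z : Fin n → ℂ | t < 1 - ∑ i, ‖z i‖ ^ 2} ∩ ball n =
        {z : Fin n → ℂ | ∑ i, ‖z i‖ ^ 2 < 1 - t} := by
      ext z
      simp only [ball, Set.mem_inter_iff, Set.mem_ofPred_eq]
      constructor
      · rintro ⟨h, -⟩; linarith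
      · intro h; constructor <;> linarith
    rw [e, volume_normSq_lt]
    have e2 : t ^ (((k + 1 : ℕ) : ℝ) - 1) = t ^ k := by
      rw [← Real.rpow_natCast]; congr 1; push_cast; ring
    rw [e2]
    by_cases h1 : t ≤ 1
    · rw [Set.indicator_of_mem (show t ∈ Set.Ioc (0 : ℝ) 1 from ⟨ht0, h1⟩),
        ENNReal.ofReal_mul (by positivity), ENNReal.ofReal_pow (p := 1 - t) (by linarith)]
      ring
    · rw [Set.indicator_of_notMem (fun h => h1 h.2), ENNReal.ofReal_of_nonpos (by linarith)]
      simp [NeZero.ne n]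
  rw [setLIntegral_congr_fun measurableSet_Ioi hset, lintegral_const_mul', ← lintegral_indicator
    measurableSet_Ioi, Set.indicator_indicator, Set.inter_eq_self_of_subset_right
    Set.Ioc_subset_Ioi_self, lintegral_indicator measurableSet_Ioc,
    ← ofReal_integral_eq_lintegral_ofReal, ← intervalIntegral.integral_of_le zero_le_one,
    integral_pow_mul_one_sub_pow, ← ENNReal.ofReal_mul (by positivity),
    ← ENNReal.ofReal_mul (by positivity)]
  · congr 1
    rw [Nat.factorial_succ k, show k + n + 1 = n + k + 1 by ring]
    have : (n ! : ℝ) ≠ 0 := by positivity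
    field_simp
    push_cast
    ring
  · exact (Continuous.integrableOn_Icc (by fun_prop)).mono_set Set.Ioc_subset_Icc_self
  · filter_upwards [ae_restrict_mem measurableSet_Ioc] with t ht
    exact mul_nonneg (pow_nonneg ht.1.le _) (pow_nonneg (by linarith [ht.2]) _)
  · simp

theorem setIntegral_ball_one_sub_normSq_pow [NeZero n] (k : ℕ) :
    ∫ z in ball n, (1 - ∑ i, ‖z i‖ ^ 2) ^ (k + 1) =
      Real.pi ^ n * (k + 1)! / (n + k + 1)! := by
  rw [integral_eq_lintegral_of_nonneg_ae, lintegral_ball_one_sub_normSq_pow,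
    ENNReal.toReal_ofReal (by positivity)]
  · filter_upwards [ae_restrict_mem isOpen_ball.measurableSet] with z hz
    exact pow_nonneg (sub_nonneg.2 (le_of_lt hz)) _
  · exact ((continuous_const.sub continuous_normSq).pow _).aestronglyMeasurable

theorem measurePreserving_smul_circle (w : Circle) :
    MeasurePreserving (fun z : Fin n → ℂ => (w : ℂ) • z) :=
  volume_preserving_pi fun _ : Fin n => (rotation w).measurePreserving

theorem smul_mem_ball {w : ℂ} (hw : ‖w‖ ≤ 1) {z : Fin n → ℂ} (hz : z ∈ ball n) :
    w • z ∈ ball n := by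
  refine lt_of_le_of_lt (Finset.sum_le_sum fun i _ => ?_ :
    ∑ i, ‖(w • z) i‖ ^ 2 ≤ ∑ i, ‖z i‖ ^ 2) hz
  rw [Pi.smul_apply, smul_eq_mul, norm_mul]
  exact pow_le_pow_left₀ (by positivity) (mul_le_of_le_one_left (norm_nonneg _) hw) 2

theorem circleAverage_smul {F : (Fin n → ℂ) → ℂ} (hF : DifferentiableOn ℂ F (ball n))
    {z : Fin n → ℂ} (hz : z ∈ ball n) :
    Real.circleAverage (fun w : ℂ => F (w • z)) 0 1 = F 0 := by
  have hd : DifferentiableOn ℂ (fun w : ℂ => F (w • z)) (Metric.closedBall 0 1) := by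
    refine hF.comp (by fun_prop) fun w hw => ?_
    exact smul_mem_ball (by simpa using hw) hz
  have : DiffContOnCl ℂ (fun w : ℂ => F (w • z)) (Metric.ball 0 |1|) := by
    rw [abs_one]
    exact DifferentiableOn.diffContOnCl (by rwa [closure_ball _ one_ne_zero])
  rw [this.circleAverage, zero_smul]

theorem measurable_indicator_ball {F : (Fin n → ℂ) → ℂ} (hF : ContinuousOn F (ball n)) :
    Measurable ((ball n).indicator F) := by
  classical
  have := hF.measurable_piecewise (g := 0) continuousOn_const isOpen_ball.measurableSet
  rwa [Set.piecewise_eq_indicator] at this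

/-- Averaging over `z ↦ wz` with `|w| = 1` does not change the integral or `ρ`. For fixed `z` the
average of `F(wz)` is `F(0)`, by the one-variable mean value property on the disc `w ↦ wz`. -/
theorem setIntegral_ball_mul_radial {F : (Fin n → ℂ) → ℂ} (hF : DifferentiableOn ℂ F (ball n))
    {ρ : (Fin n → ℂ) → ℂ} (hρm : Measurable ρ) (hρ : ∀ (w : Circle) z, ρ ((w : ℂ) • z) = ρ z)
    (hint : IntegrableOn (fun z => F z * ρ z) (ball n)) :
    ∫ z in ball n, F z * ρ z = F 0 * ∫ z in ball n, ρ z := by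
  have hb := (isOpen_ball (n := n)).measurableSet
  set G : (Fin n → ℂ) → ℂ := (ball n).indicator (fun z => F z * ρ z) with hG
  have hGm : Measurable G := by
    have : G = fun z => (ball n).indicator F z * ρ z := by
      ext z; by_cases h : z ∈ ball n <;> simp [hG, h]
    rw [this]
    exact (measurable_indicator_ball hF.continuousOn).mul hρm
  have hGi : Integrable G := hint.integrable_indicator hb
  have hcirc : ∀ θ : ℝ, circleMap 0 1 θ = (Circle.exp θ : ℂ) := by
    intro θ; simp [circleMap, Circle.coe_exp]
  have hmp : ∀ θ : ℝ, MeasurePreserving (fun z : Fin n → ℂ => circleMap 0 1 θ • z) := by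
    intro θ
    rw [hcirc]
    exact measurePreserving_smul_circle _
  have hrot : ∀ θ : ℝ, ∫ z, G (circleMap 0 1 θ • z) = ∫ z, G z := by
    intro θ
    rw [← (hmp θ).map_eq, integral_map_of_stronglyMeasurable (hmp θ).measurable
      hGm.stronglyMeasurable, (hmp θ).map_eq]
  have hrot' : ∀ θ : ℝ, ∫ z, ‖G (circleMap 0 1 θ • z)‖ = ∫ z, ‖G z‖ := by
    intro θ
    rw [← (hmp θ).map_eq, integral_map_of_stronglyMeasurable (hmp θ).measurable
      hGm.norm.stronglyMeasurable, (hmp θ).map_eq]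
  -- Fubini is justified because the `L¹` norm of a rotated function does not depend on the angle.
  have hprod : Integrable (Function.uncurry fun (θ : ℝ) (z : Fin n → ℂ) => G (circleMap 0 1 θ • z))
      ((volume.restrict (Set.Ioc 0 (2 * Real.pi))).prod volume) := by
    have hm : Measurable
        (Function.uncurry fun (θ : ℝ) (z : Fin n → ℂ) => G (circleMap 0 1 θ • z)) := by
      refine hGm.comp (Continuous.measurable ?_)
      exact ((continuous_circleMap 0 1).comp continuous_fst).smul continuous_snd
    rw [integrable_prod_iff hm.aestronglyMeasurable]
    refine ⟨Filter.Eventually.of_forall fun θ => ?_, ?_⟩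
    · exact (hmp θ).integrable_comp_of_integrable hGi
    · simp only [Function.uncurry_apply_pair, hrot']
      exact integrable_const _
  have hswap := integral_integral_swap hprod
  have hin : ∀ z, ∫ θ in Set.Ioc 0 (2 * Real.pi), G (circleMap 0 1 θ • z) =
      (2 * Real.pi * F 0) * (ball n).indicator ρ z := by
    intro z
    have hG' : ∀ θ : ℝ, G (circleMap 0 1 θ • z) =
        (ball n).indicator ρ z * F (circleMap 0 1 θ • z) := by
      intro θ
      by_cases hz : z ∈ ball n
      · have h1 : circleMap 0 1 θ • z ∈ ball n := smul_mem_ball (by simp) hz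
        rw [hG, Set.indicator_of_mem h1, Set.indicator_of_mem hz, hcirc, hρ, mul_comm]
      · have h1 : circleMap 0 1 θ • z ∉ ball n := fun h => hz <| by
          have := smul_mem_ball (w := ((Circle.exp θ)⁻¹ : Circle)) (by simp) h
          rwa [hcirc, smul_smul, Circle.coe_inv, inv_mul_cancel₀ (Circle.coe_ne_zero _),
            one_smul] at this
        rw [hG, Set.indicator_of_notMem h1, Set.indicator_of_notMem hz, zero_mul]
    simp only [hG']
    rw [integral_const_mul, ← intervalIntegral.integral_of_le (by positivity)]
    by_cases hz : z ∈ ball n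
    · have h2 := circleAverage_smul hF hz
      rw [Real.circleAverage_def, Complex.real_smul, Complex.ofReal_inv,
        inv_mul_eq_iff_eq_mul₀ (by simp [Real.pi_ne_zero])] at h2
      rw [h2]
      push_cast
      ring
    · simp [hz]
  simp only [hrot, hin] at hswap
  rw [integral_const_mul, integral_indicator hb, setIntegral_const, integral_indicator hb,
    Complex.real_smul] at hswap
  simp only [Real.volume_real_Ioc, sub_zero, max_eq_left Real.two_pi_pos.le] at hswap
  have h2 : (2 * Real.pi : ℂ) ≠ 0 := by simp [Real.pi_ne_zero]
  push_cast at hswap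
  refine mul_left_cancel₀ h2 ?_
  linear_combination hswap

end BallIntegral
/-! ### Integrals over the group -/

section GroupIntegral

variable {n : ℕ}

theorem continuous_mat : Continuous (mat : SU n → Matrix (Fin n ⊕ Unit) (Fin n ⊕ Unit) ℂ) :=
  continuous_subtype_val.comp continuous_subtype_val

theorem continuous_mat_mulVec (v : Fin n ⊕ Unit → ℂ) : Continuous fun g : SU n => mat g *ᵥ v :=
  continuous_mat.matrix_mulVec continuous_const

theorem continuous_herm {α : Type*} [TopologicalSpace α] {u v : α → Fin n ⊕ Unit → ℂ}
    (hu : Continuous u) (hv : Continuous v) : Continuous fun x => herm (u x) (v x) := by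
  unfold herm; fun_prop

theorem continuous_denom_zero : Continuous fun g : SU n => denom g 0 :=
  (continuous_apply _).comp (continuous_mat_mulVec _)

theorem continuous_j_zero : Continuous fun g : SU n => j g 0 :=
  continuous_denom_zero.inv₀ fun g => denom_ne_zero g zero_mem_ball

theorem continuous_act_zero : Continuous fun g : SU n => act g 0 :=
  continuous_pi fun _ => ((continuous_apply _).comp (continuous_mat_mulVec _)).div
    continuous_denom_zero fun g => denom_ne_zero g zero_mem_ball

theorem continuous_lift (m : ℕ) {f : (Fin n → ℂ) → ℂ} (hf : ContinuousOn f (ball n)) :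
    Continuous (lift m f) :=
  (hf.comp_continuous continuous_act_zero fun g => act_mem_ball g zero_mem_ball).mul
    (continuous_j_zero.pow _)

instance instSecondCountableTopologySU : SecondCountableTopology (SU n) := by
  have : SecondCountableTopology (Matrix (Fin n ⊕ Unit) (Fin n ⊕ Unit) ℂ) :=
    inferInstanceAs (SecondCountableTopology (Fin n ⊕ Unit → Fin n ⊕ Unit → ℂ))
  have : SecondCountableTopology (Matrix.SpecialLinearGroup (Fin n ⊕ Unit) ℂ) :=
    Topology.IsInducing.secondCountableTopology (f := Subtype.val) ⟨rfl⟩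
  exact Topology.IsInducing.secondCountableTopology (f := Subtype.val) ⟨rfl⟩

theorem differentiable_mat_mulVec_emb (g : SU n) (k : Fin n ⊕ Unit) :
    Differentiable ℂ fun z : Fin n → ℂ => (mat g *ᵥ emb z) k := by
  simp only [mulVec, dotProduct, emb, Fintype.sum_sum_type, Sum.elim_inl, Sum.elim_inr]
  fun_prop

theorem differentiableOn_slash (m : ℕ) {f : (Fin n → ℂ) → ℂ} (hf : DifferentiableOn ℂ f (ball n))
    (g : SU n) : DifferentiableOn ℂ (slash m f g) (ball n) := by
  have hd : DifferentiableOn ℂ (denom g) (ball n) :=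
    (differentiable_mat_mulVec_emb g (Sum.inr ())).differentiableOn
  have ha : DifferentiableOn ℂ (act g) (ball n) := by
    rw [differentiableOn_pi]
    intro i
    simp only [act, div_eq_mul_inv]
    exact (differentiable_mat_mulVec_emb g (Sum.inl i)).differentiableOn.mul
      (hd.inv fun z hz => denom_ne_zero g hz)
  exact (hf.comp ha fun z hz => act_mem_ball g hz).mul
    ((hd.inv fun z hz => denom_ne_zero g hz).pow _)

theorem measurable_hypDensity :
    Measurable fun z : Fin n → ℂ => ENNReal.ofReal (4 ^ n / (1 - ∑ i, ‖z i‖ ^ 2) ^ (n + 1)) := by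
  fun_prop

theorem hypDensity_toReal {z : Fin n → ℂ} (hz : z ∈ ball n) :
    (ENNReal.ofReal (4 ^ n / (1 - ∑ i, ‖z i‖ ^ 2) ^ (n + 1))).toReal =
      4 ^ n / (1 - ∑ i, ‖z i‖ ^ 2) ^ (n + 1) := by
  have : 0 < 1 - ∑ i, ‖z i‖ ^ 2 := sub_pos.2 hz
  rw [ENNReal.toReal_ofReal (by positivity)]

theorem integrable_hypVolume_iff {ψ : (Fin n → ℂ) → ℂ} :
    Integrable ψ (hypVolume n) ↔
      IntegrableOn (fun z => ((4 ^ n / (1 - ∑ i, ‖z i‖ ^ 2) ^ (n + 1) : ℝ) : ℂ) * ψ z)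
        (ball n) := by
  rw [hypVolume, integrable_withDensity_iff_integrable_smul' measurable_hypDensity
    (Filter.Eventually.of_forall fun _ => ENNReal.ofReal_lt_top)]
  refine integrable_congr ?_
  filter_upwards [ae_restrict_mem isOpen_ball.measurableSet] with z hz
  rw [hypDensity_toReal hz, Complex.real_smul]

theorem integral_hypVolume (ψ : (Fin n → ℂ) → ℂ) :
    ∫ z, ψ z ∂hypVolume n =
      ∫ z in ball n, ((4 ^ n / (1 - ∑ i, ‖z i‖ ^ 2) ^ (n + 1) : ℝ) : ℂ) * ψ z := by
  rw [hypVolume, integral_withDensity_eq_integral_toReal_smul measurable_hypDensity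
    (Filter.Eventually.of_forall fun _ => ENNReal.ofReal_lt_top)]
  refine integral_congr_ae ?_
  filter_upwards [ae_restrict_mem isOpen_ball.measurableSet] with z hz
  rw [hypDensity_toReal hz, Complex.real_smul]

instance instSigmaFiniteHypVolume : SigmaFinite (hypVolume n) := by
  unfold hypVolume
  exact SigmaFinite.withDensity_ofReal _

theorem sigmaFinite_of_map_act {μ : Measure (SU n)}
    (hμ : Measure.map (fun g : SU n => act g 0) μ = hypVolume n) : SigmaFinite μ := by
  have : SigmaFinite (Measure.map (fun g : SU n => act g 0) μ) := hμ ▸ instSigmaFiniteHypVolume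
  exact SigmaFinite.of_map μ continuous_act_zero.aemeasurable this

theorem volume_ball_lt_top [NeZero n] : volume (ball n) < ⊤ := by
  rw [ball, volume_normSq_lt]
  exact ENNReal.mul_lt_top (by simp) (by simp)

/-- On the ball the norm is `(1-|z|²)^m` against the density `4ⁿ(1-|z|²)^{-(n+1)}`, so the product
is bounded once `m ≥ n+1`. This is the role of `κ ≥ 1`. -/
theorem integrable_j_pow [NeZero n] {μ : Measure (SU n)}
    (hμ : Measure.map (fun g : SU n => act g 0) μ = hypVolume n) {m : ℕ} (hm : n + 1 ≤ m) :
    Integrable (fun g : SU n => j g 0 ^ (2 * m)) μ := by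
  have h1 : Integrable (fun z : Fin n → ℂ => ((1 - ∑ i, ‖z i‖ ^ 2 : ℝ) : ℂ) ^ m)
      (hypVolume n) := by
    rw [integrable_hypVolume_iff]
    refine Measure.integrableOn_of_bounded (M := 4 ^ n) volume_ball_lt_top.ne
      (Measurable.aestronglyMeasurable (by fun_prop)) ?_
    filter_upwards [ae_restrict_mem isOpen_ball.measurableSet] with z hz
    have h0 : 0 < 1 - ∑ i, ‖z i‖ ^ 2 := sub_pos.2 hz
    have h1 : 1 - ∑ i, ‖z i‖ ^ 2 ≤ 1 := by
      have : 0 ≤ ∑ i, ‖z i‖ ^ 2 := by positivity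
      linarith
    rw [← Complex.ofReal_pow, ← Complex.ofReal_mul, Complex.norm_real, Real.norm_of_nonneg
      (by positivity)]
    obtain ⟨k, rfl⟩ := Nat.exists_eq_add_of_le hm
    generalize 1 - ∑ i, ‖z i‖ ^ 2 = x at *
    have e : 4 ^ n / x ^ (n + 1) * x ^ (n + 1 + k) = 4 ^ n * x ^ k := by
      rw [pow_add x (n + 1) k]
      field_simp
    rw [e]
    exact mul_le_of_le_one_right (by positivity) (pow_le_one₀ h0.le h1)
  rw [← hμ] at h1
  have h2 := h1.comp_measurable continuous_act_zero.measurable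
  have hc : Continuous fun g : SU n => j g 0 ^ (2 * m) := continuous_j_zero.pow _
  refine (integrable_norm_iff hc.aestronglyMeasurable).1 ?_
  refine h2.norm.congr (Filter.Eventually.of_forall fun g => ?_)
  simp only [Function.comp, Complex.norm_real, norm_pow, pow_mul]
  rw [← norm_j_zero_sq, Real.norm_of_nonneg (by positivity)]

theorem setIntegral_ball_hyp [NeZero n] {m : ℕ} (hm : n + 1 ≤ m) :
    ∫ z in ball n, 4 ^ n / (1 - ∑ i, ‖z i‖ ^ 2) ^ (n + 1) * (1 - ∑ i, ‖z i‖ ^ 2) ^ (2 * m) =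
      4 ^ n * Real.pi ^ n * (2 * m - n - 1)! / (2 * m - 1)! := by
  obtain ⟨k, rfl⟩ := Nat.exists_eq_add_of_le hm
  -- With `m = n + 1 + k` the truncated subtractions inside the factorials are genuine ones.
  have e1 : 2 * (n + 1 + k) - n - 1 = n + 2 * k + 1 := by omega
  have e2 : 2 * (n + 1 + k) - 1 = n + (n + 2 * k) + 1 := by omega
  rw [e1, e2]
  have := setIntegral_ball_one_sub_normSq_pow (n := n) (n + 2 * k)
  rw [mul_assoc, mul_div_assoc, ← this, ← integral_const_mul]
  refine setIntegral_congr_fun isOpen_ball.measurableSet fun z hz => ?_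
  have h0 : 1 - ∑ i, ‖z i‖ ^ 2 ≠ 0 := (sub_pos.2 hz).ne'
  generalize 1 - ∑ i, ‖z i‖ ^ 2 = x at *
  field_simp
  ring

theorem integrable_star {α : Type*} [MeasurableSpace α] {ν : Measure α} {u : α → ℂ}
    (hu : Integrable u ν) : Integrable (fun x => star (u x)) ν :=
  hu.norm.mono' hu.1.star (Filter.Eventually.of_forall fun _ => (norm_star _).le)

/-- The reproducing property at the identity: the two automorphy factors combine to `|j|^{4m} =
(1-|z|²)^{2m}`, so the integral descends to the ball with a radial weight. -/
theorem integral_lift_mul_star_j_pow [NeZero n] {μ : Measure (SU n)}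
    (hμ : Measure.map (fun g : SU n => act g 0) μ = hypVolume n) {m : ℕ} (hm : n + 1 ≤ m)
    {f : (Fin n → ℂ) → ℂ} (hf : DifferentiableOn ℂ f (ball n)) {M : ℝ}
    (hM : ∀ g, ‖lift m f g‖ ≤ M) :
    ∫ g, lift m f g * star (j g 0 ^ (2 * m)) ∂μ =
      f 0 * (4 ^ n * Real.pi ^ n * (2 * m - n - 1)! / (2 * m - 1)! : ℝ) := by
  have hint : Integrable (fun g => lift m f g * star (j g 0 ^ (2 * m))) μ :=
    (integrable_star (integrable_j_pow hμ hm)).bdd_mul (c := M)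
      (continuous_lift m hf.continuousOn).aestronglyMeasurable (Filter.Eventually.of_forall hM)
  -- The indicator secures measurability on all of `ℂⁿ`, as nothing is known about `f` off the ball.
  set ψ : (Fin n → ℂ) → ℂ := fun z =>
    (ball n).indicator f z * ((1 - ∑ i, ‖z i‖ ^ 2 : ℝ) : ℂ) ^ (2 * m) with hψ
  have hψm : Measurable ψ :=
    (measurable_indicator_ball hf.continuousOn).mul (by fun_prop)
  have e : ∀ g : SU n, lift m f g * star (j g 0 ^ (2 * m)) = ψ (act g 0) := by
    intro g
    simp only [hψ]
    rw [Set.indicator_of_mem (act_mem_ball g zero_mem_ball), ← norm_j_zero_sq, lift, mul_assoc,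
      star_pow, ← mul_pow, Complex.star_def, Complex.mul_conj, Complex.normSq_eq_norm_sq]
  simp only [e] at hint ⊢
  have hψi : Integrable ψ (hypVolume n) := by
    rw [← hμ]
    exact (integrable_map_measure hψm.aestronglyMeasurable
      continuous_act_zero.aemeasurable).2 hint
  rw [← integral_map_of_stronglyMeasurable continuous_act_zero.measurable hψm.stronglyMeasurable,
    hμ, integral_hypVolume]
  rw [integrable_hypVolume_iff] at hψi
  set ρ : (Fin n → ℂ) → ℂ := fun z => ((4 ^ n / (1 - ∑ i, ‖z i‖ ^ 2) ^ (n + 1) *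
    (1 - ∑ i, ‖z i‖ ^ 2) ^ (2 * m) : ℝ) : ℂ) with hρ
  have hψρ : ∀ z ∈ ball n, ((4 ^ n / (1 - ∑ i, ‖z i‖ ^ 2) ^ (n + 1) : ℝ) : ℂ) * ψ z =
      f z * ρ z := by
    intro z hz
    simp only [hψ, hρ, Set.indicator_of_mem hz]
    push_cast
    ring
  rw [setIntegral_congr_fun isOpen_ball.measurableSet hψρ]
  rw [integrableOn_congr_fun hψρ isOpen_ball.measurableSet] at hψi
  have hρi : ∫ z in ball n, ρ z =
      ((4 ^ n * Real.pi ^ n * (2 * m - n - 1)! / (2 * m - 1)! : ℝ) : ℂ) := by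
    rw [← setIntegral_ball_hyp hm]
    exact integral_ofReal
  rw [setIntegral_ball_mul_radial hf (by fun_prop) _ hψi, hρi]
  intro w z
  simp only [hρ, Pi.smul_apply, smul_eq_mul, norm_mul, Circle.norm_coe, one_mul]

theorem herm_mat_mul_emb_zero_pow_inv (m : ℕ) (g h : SU n) :
    (herm (mat (h * g) *ᵥ emb 0) (mat h *ᵥ emb 0) ^ (2 * m))⁻¹ = j g 0 ^ (2 * m) := by
  rw [herm_mat_mulVec_emb_zero, inv_mul_cancel_left, Even.neg_pow (even_two_mul m), j, inv_pow]

theorem integrable_herm_pow_inv [NeZero n] {μ : Measure (SU n)} [μ.IsHaarMeasure]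
    (hμ : Measure.map (fun g : SU n => act g 0) μ = hypVolume n) {m : ℕ} (hm : n + 1 ≤ m)
    (h : SU n) :
    Integrable (fun g : SU n => (herm (mat g *ᵥ emb 0) (mat h *ᵥ emb 0) ^ (2 * m))⁻¹) μ := by
  have hc : Continuous fun g : SU n => (herm (mat g *ᵥ emb 0) (mat h *ᵥ emb 0) ^ (2 * m))⁻¹ := by
    simp only [herm_mat_mulVec_emb_zero, Even.neg_pow (even_two_mul m)]
    exact ((continuous_denom_zero.comp (continuous_const_mul h⁻¹)).pow _).inv₀
      fun g => pow_ne_zero _ (denom_ne_zero _ zero_mem_ball)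
  rw [← (measurePreserving_mul_left μ h).integrable_comp hc.aestronglyMeasurable]
  simp only [Function.comp_def, herm_mat_mul_emb_zero_pow_inv]
  exact integrable_j_pow hμ hm

/-- The value is independent of `h`, which gives the uniform bound in `t` needed for Fubini along
the geodesic. -/
theorem integral_norm_herm_pow_inv {μ : Measure (SU n)} [μ.IsHaarMeasure] (m : ℕ) (h : SU n) :
    ∫ g : SU n, ‖(herm (mat g *ᵥ emb 0) (mat h *ᵥ emb 0) ^ (2 * m))⁻¹‖ ∂μ =
      ∫ g : SU n, ‖j g 0 ^ (2 * m)‖ ∂μ := by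
  rw [← integral_mul_left_eq_self _ h]
  simp only [herm_mat_mul_emb_zero_pow_inv]

theorem integral_lift_mul_star_herm_pow_inv [NeZero n] {μ : Measure (SU n)} [μ.IsHaarMeasure]
    (hμ : Measure.map (fun g : SU n => act g 0) μ = hypVolume n) {m : ℕ} (hm : n + 1 ≤ m)
    {f : (Fin n → ℂ) → ℂ} (hf : DifferentiableOn ℂ f (ball n)) {M : ℝ}
    (hM : ∀ g, ‖lift m f g‖ ≤ M) (h : SU n) :
    ∫ g, lift m f g * star ((herm (mat g *ᵥ emb 0) (mat h *ᵥ emb 0) ^ (2 * m))⁻¹) ∂μ =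
      lift m f h * (4 ^ n * Real.pi ^ n * (2 * m - n - 1)! / (2 * m - 1)! : ℝ) := by
  rw [← integral_mul_left_eq_self _ h]
  simp only [herm_mat_mul_emb_zero_pow_inv, lift_mul]
  -- After translating by `h`, the identity case applies to `f|h`, whose value at `0` is `lift m f
  -- h` by definition.
  exact integral_lift_mul_star_j_pow hμ hm (differentiableOn_slash m hf h)
    fun g => by rw [← lift_mul]; exact hM _

end GroupIntegral
/-! ### Unfolding -/

section Unfolding

variable {G : Type*} [Group G] {α : Type*} [MeasurableSpace α] [MulAction G α]
  [MeasurableConstSMul G α] {μ : Measure α} [SMulInvariantMeasure G α μ] {D : Set α} {F : α → ℂ}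

theorem integrable_comp_const_smul (hF : Integrable F μ) (γ : G) :
    Integrable (fun x => F (γ • x)) μ :=
  (measurePreserving_smul γ μ).integrable_comp_of_integrable hF

variable [Countable G]

/-- Translates of the fundamental domain tile the space, so this integral is the `L¹` norm of `F`.
-/
theorem lintegral_tsum_enorm_smul_ne_top (hD : IsFundamentalDomain G D μ) (hF : Integrable F μ) :
    ∫⁻ x in D, ∑' γ : G, ‖F (γ • x)‖ₑ ∂μ ≠ ⊤ := by
  rw [lintegral_tsum fun γ => (integrable_comp_const_smul hF γ).1.restrict.enorm,
    ← hD.lintegral_eq_tsum'' fun x => ‖F x‖ₑ]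
  exact hF.2.ne

theorem ae_summable_smul (hD : IsFundamentalDomain G D μ) (hF : Integrable F μ) :
    ∀ᵐ x ∂μ.restrict D, Summable fun γ : G => F (γ • x) := by
  have h := ae_lt_top' (AEMeasurable.tsum fun γ : G =>
    (integrable_comp_const_smul hF γ).1.restrict.enorm)
    (lintegral_tsum_enorm_smul_ne_top hD hF)
  filter_upwards [h] with x hx
  have := ENNReal.tsum_coe_ne_top_iff_summable.1 hx.ne
  exact Summable.of_norm (NNReal.summable_coe.2 this)

theorem integrableOn_tsum_smul (hD : IsFundamentalDomain G D μ) (hF : Integrable F μ) :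
    IntegrableOn (fun x => ∑' γ : G, F (γ • x)) D μ := by
  refine ⟨?_, ?_⟩
  · refine aestronglyMeasurable_of_tendsto_ae (Filter.atTop : Filter (Finset G))
      (f := fun S x => ∑ γ ∈ S, F (γ • x)) (fun S => ?_) ?_
    · exact Finset.aestronglyMeasurable_fun_sum S
        fun γ _ => (integrable_comp_const_smul hF γ).1.restrict
    · filter_upwards [ae_summable_smul hD hF] with x hx
      exact hx.hasSum
  · refine lt_of_le_of_lt (lintegral_mono_ae ?_)
      (lintegral_tsum_enorm_smul_ne_top hD hF).lt_top
    filter_upwards [ae_summable_smul hD hF] with x hx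
    exact enorm_tsum_le_tsum_enorm

theorem setIntegral_tsum_smul (hD : IsFundamentalDomain G D μ) (hF : Integrable F μ) :
    ∫ x in D, ∑' γ : G, F (γ • x) ∂μ = ∫ x, F x ∂μ := by
  rw [hD.integral_eq_tsum'' F hF, integral_tsum]
  · exact fun γ => (integrable_comp_const_smul hF γ).1.restrict
  · rw [← hD.lintegral_eq_tsum'' fun x => ‖F x‖ₑ]
    exact hF.2.ne

end Unfolding

/-! ### Sums over translates of an interval, and over cosets of a cyclic group -/

section Translates

/-- The translates of `(0,|s|]` tile the line. Negative `s` is allowed because the exponent in the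
definition of a loxodromic element may have either sign. -/
theorem hasSum_setIntegral_Ioc_sub_zsmul {s : ℝ} (hs : s ≠ 0) {u : ℝ → ℂ} (hu : Integrable u) :
    HasSum (fun k : ℤ => ∫ t in Set.Ioc 0 |s|, u (t - k * s)) (∫ t, u t) := by
  have hpos : ∀ p : ℝ, 0 < p →
      HasSum (fun k : ℤ => ∫ t in Set.Ioc 0 p, u (t + k * p)) (∫ t, u t) := by
    intro p hp
    have h := hasSum_integral_iUnion (μ := volume) (f := u)
      (s := fun k : ℤ => Set.Ioc (k • p) ((k + 1) • p)) (fun _ => measurableSet_Ioc)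
      (Set.pairwise_disjoint_Ioc_zsmul p) hu.integrableOn
    rw [iUnion_Ioc_zsmul hp, setIntegral_univ] at h
    have e : (fun k : ℤ => ∫ t in Set.Ioc 0 p, u (t + k * p)) =
        fun k : ℤ => ∫ t in Set.Ioc (k • p) ((k + 1) • p), u t := funext fun k => ?_
    · rw [e]; exact h
    rw [← intervalIntegral.integral_of_le hp.le, intervalIntegral.integral_comp_add_right u,
      intervalIntegral.integral_of_le (by linarith)]
    congr 2
    simp only [zsmul_eq_mul, Int.cast_add, Int.cast_one]
    congr 1 <;> ring
  rcases lt_or_gt_of_ne hs with h | h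
  · rw [abs_of_neg h]
    convert hpos (-s) (neg_pos.2 h) using 5
    ring
  · rw [abs_of_pos h]
    -- For `s > 0` the shift by `-ks` requires reindexing by `k ↦ -k`.
    convert (Equiv.neg ℤ).hasSum_iff.2 (hpos s h) using 2 with k
    simp [sub_eq_add_neg]

end Translates

section Cosets

variable {n : ℕ} {Γ : Subgroup (SU n)}

/-- The parametrization of `Γ` by `⟨γ₀⟩ \ Γ × ℤ`, for `γ₀` of infinite order. -/
noncomputable def cosetEquiv (γ₀ : Γ) (h : Function.Injective fun k : ℤ => γ₀ ^ k) :
    CyclicCosets γ₀ × ℤ ≃ Γ :=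
  Equiv.ofBijective (fun p => γ₀ ^ p.2 * Quotient.out p.1) <| by
    have hmk : ∀ (c : CyclicCosets γ₀) (k : ℤ),
        (Quotient.mk _ (γ₀ ^ k * Quotient.out c) : CyclicCosets γ₀) = c := by
      intro c k
      conv_rhs => rw [← Quotient.out_eq c]
      refine Quotient.sound ?_
      change QuotientGroup.rightRel _ _ _
      rw [QuotientGroup.rightRel_apply, _root_.mul_inv_rev, mul_inv_cancel_left]
      exact Subgroup.inv_mem _ (Subgroup.zpow_mem_zpowers _ _)
    constructor
    · rintro ⟨c, k⟩ ⟨c', k'⟩ hcc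
      simp only at hcc
      have h1 : c = c' := by rw [← hmk c k, hcc, hmk]
      subst h1
      have h2 : k = k' := h (mul_right_cancel hcc)
      rw [h2]
    · intro γ
      have h1 : QuotientGroup.rightRel (Subgroup.zpowers γ₀)
          (Quotient.out (Quotient.mk _ γ : CyclicCosets γ₀)) γ := Quotient.mk_out γ
      rw [QuotientGroup.rightRel_apply] at h1
      obtain ⟨k, hk⟩ := h1
      refine ⟨(Quotient.mk _ γ, k), ?_⟩
      simp only at hk ⊢
      rw [hk, inv_mul_cancel_right]

theorem hasSum_cosets {γ₀ : Γ} (h : Function.Injective fun k : ℤ => γ₀ ^ k) {u : Γ → ℂ}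
    (hu : Summable u) {v : CyclicCosets γ₀ → ℂ}
    (huv : ∀ c, HasSum (fun k : ℤ => u (γ₀ ^ k * Quotient.out c)) (v c)) :
    HasSum v (∑' γ, u γ) := by
  have h1 : HasSum (fun p => u (cosetEquiv γ₀ h p)) (∑' γ, u γ) :=
    (cosetEquiv γ₀ h).hasSum_iff.2 hu.hasSum
  exact h1.prod_fiberwise huv

end Cosets

/-! ### The kernel of the period along a geodesic -/

section Kernel

variable {n : ℕ} [NeZero n]

/-- The kernel `⟨g e, h a_t e⟩^{-2m}`, where `e` is the last basis vector. -/
noncomputable def geodesicKernel (m : ℕ) (h : SU n) (g : SU n) (t : ℝ) : ℂ :=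
  (herm (mat g *ᵥ emb 0) (mat (h * flow n t) *ᵥ emb 0) ^ (2 * m))⁻¹

theorem herm_mat_mul_flow (v : Fin n ⊕ Unit → ℂ) (h : SU n) (t : ℝ) :
    herm v (mat (h * flow n t) *ᵥ emb 0) =
      expPair (herm v (mat h *ᵥ nullPlus n)) (herm v (mat h *ᵥ nullMinus n)) t := by
  rw [mat_mul_flow_mulVec, herm_add_right, herm_smul_right, herm_smul_right, expPair,
    Complex.star_def, ← Complex.exp_conj, ← Complex.exp_conj, map_neg,
    Complex.conj_ofReal]

theorem herm_mat_mul_flow_ne_zero (g h : SU n) (t : ℝ) :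
    herm (mat g *ᵥ emb 0) (mat (h * flow n t) *ᵥ emb 0) ≠ 0 := by
  rw [herm_mat_mulVec_emb_zero]
  exact neg_ne_zero.2 (denom_ne_zero _ zero_mem_ball)

/-- The vector `g e` has form `-1`, so every other coordinate is dominated by the last. Hence its
pairings with the null vectors `(±eₙ + eₙ₊₁)/2` cannot vanish. -/
theorem norm_top_lt_norm_last (g : SU n) :
    ‖(mat g *ᵥ emb 0) (Sum.inl ⊤)‖ < ‖(mat g *ᵥ emb 0) (Sum.inr ())‖ := by
  have h1 := herm_mulVec (preservesForm_mat g) (emb 0) (emb 0)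
  rw [herm_emb_self, herm_self, Complex.ofReal_inj] at h1
  have h2 : ‖(mat g *ᵥ emb 0) (Sum.inl ⊤)‖ ^ 2 ≤ ∑ i, ‖(mat g *ᵥ emb 0) (Sum.inl i)‖ ^ 2 :=
    Finset.single_le_sum (f := fun i => ‖(mat g *ᵥ emb 0) (Sum.inl i)‖ ^ 2)
      (fun _ _ => by positivity) (Finset.mem_univ _)
  simp only [Pi.zero_apply, norm_zero] at h1
  refine lt_of_pow_lt_pow_left₀ 2 (norm_nonneg _) ?_
  simp at h1
  linarith

theorem herm_nullPlus_ne_zero (g h : SU n) :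
    herm (mat g *ᵥ emb 0) (mat h *ᵥ nullPlus n) ≠ 0 := by
  rw [← inv_inv h, ← herm_mat_mulVec, mulVec_mulVec, ← mat_mul, herm_nullPlus_right]
  have := norm_top_lt_norm_last (h⁻¹ * g)
  intro h0
  rw [div_eq_zero_iff, or_iff_left two_ne_zero, sub_eq_zero] at h0
  rw [h0] at this
  exact lt_irrefl _ this

theorem herm_nullMinus_ne_zero (g h : SU n) :
    herm (mat g *ᵥ emb 0) (mat h *ᵥ nullMinus n) ≠ 0 := by
  rw [← inv_inv h, ← herm_mat_mulVec, mulVec_mulVec, ← mat_mul, herm_nullMinus_right]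
  have := norm_top_lt_norm_last (h⁻¹ * g)
  intro h0
  rw [div_eq_zero_iff, or_iff_left two_ne_zero, neg_eq_zero, add_eq_zero_iff_eq_neg] at h0
  rw [h0, norm_neg] at this
  exact lt_irrefl _ this

theorem continuous_geodesicKernel (m : ℕ) (h : SU n) :
    Continuous fun p : SU n × ℝ => geodesicKernel m h p.1 p.2 := by
  have h1 : Continuous fun p : SU n × ℝ => mat p.1 *ᵥ emb 0 :=
    (continuous_mat_mulVec _).comp continuous_fst
  have h2 : Continuous fun p : SU n × ℝ => mat (h * flow n p.2) *ᵥ emb 0 := by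
    simp only [mat_mul_flow_mulVec]
    fun_prop
  have h3 : Continuous fun p : SU n × ℝ =>
      herm (mat p.1 *ᵥ emb 0) (mat (h * flow n p.2) *ᵥ emb 0) :=
    continuous_herm h1 h2
  have h4 : ∀ p : SU n × ℝ,
      herm (mat p.1 *ᵥ emb 0) (mat (h * flow n p.2) *ᵥ emb 0) ^ (2 * m) ≠ 0 := fun p =>
    pow_ne_zero _ (herm_mat_mul_flow_ne_zero _ _ _)
  simp only [geodesicKernel]
  exact (h3.pow (2 * m)).inv₀ h4

/-- The constant `((m-1)!)² / (2 (2m-1)!)`, the value of `∫ (2 cosh t)^{-2m} dt`. -/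
noncomputable def coshConst (m : ℕ) : ℝ := ((m - 1)! : ℝ) ^ 2 / (2 * (2 * m - 1)!)

theorem coshConst_ne_zero (m : ℕ) : coshConst m ≠ 0 := by
  unfold coshConst; positivity

theorem geodesicKernel_eq (m : ℕ) (h g : SU n) (t : ℝ) :
    geodesicKernel m h g t = (expPair (herm (mat g *ᵥ emb 0) (mat h *ᵥ nullPlus n))
      (herm (mat g *ᵥ emb 0) (mat h *ᵥ nullMinus n)) t ^ (2 * m))⁻¹ := by
  rw [geodesicKernel, herm_mat_mul_flow]

theorem expPair_herm_ne_zero (h g : SU n) (t : ℝ) :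
    expPair (herm (mat g *ᵥ emb 0) (mat h *ᵥ nullPlus n))
      (herm (mat g *ᵥ emb 0) (mat h *ᵥ nullMinus n)) t ≠ 0 := by
  rw [← herm_mat_mul_flow]
  exact herm_mat_mul_flow_ne_zero g h t

theorem integrable_geodesicKernel {m : ℕ} (hm : 1 ≤ m) (h g : SU n) :
    Integrable (geodesicKernel m h g) := by
  obtain ⟨k, rfl⟩ := Nat.exists_eq_add_of_le' hm
  rw [show geodesicKernel (k + 1) h g = _ from funext (geodesicKernel_eq (k + 1) h g)]
  exact integrable_expPair_pow_inv (herm_nullPlus_ne_zero g h) (herm_nullMinus_ne_zero g h)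
    (expPair_herm_ne_zero h g) (2 * k + 1)

/-- The right side is, up to a constant, the lift of `q` when the ends of the geodesic of `h` are
`X` and `Y`. -/
theorem integral_geodesicKernel {m : ℕ} (hm : 1 ≤ m) (h g : SU n) :
    ∫ t, geodesicKernel m h g t =
      ((herm (mat g *ᵥ emb 0) (mat h *ᵥ nullPlus n) *
        herm (mat g *ᵥ emb 0) (mat h *ᵥ nullMinus n)) ^ m)⁻¹ * coshConst m := by
  obtain ⟨k, rfl⟩ := Nat.exists_eq_add_of_le' hm
  simp only [geodesicKernel_eq]
  rw [integral_expPair_pow_inv (herm_nullPlus_ne_zero g h) (herm_nullMinus_ne_zero g h)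
    (expPair_herm_ne_zero h g), coshConst]
  push_cast
  rfl

/-- `γ` translates the geodesic `t ↦ h a_t` by `s`, up to a scalar `ζ` with `ζ^{2m} = 1`. -/
structure TranslatesGeodesic (m : ℕ) (γ h : SU n) (s : ℝ) (ζ : ℂ) : Prop where
  pow_eq : ζ ^ (2 * m) = 1
  mulVec_eq : ∀ t, mat γ *ᵥ (mat (h * flow n t) *ᵥ emb 0) =
    ζ • (mat (h * flow n (t + s)) *ᵥ emb 0)

/-- Since `γ` preserves the form, it can be moved to the second slot, where it shifts the parameter;
the scalar disappears in the power `2m`. -/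
theorem TranslatesGeodesic.geodesicKernel_mul {m : ℕ} {γ h : SU n} {s : ℝ} {ζ : ℂ}
    (H : TranslatesGeodesic m γ h s ζ) (g : SU n) (t : ℝ) :
    geodesicKernel m h (γ * g) t = geodesicKernel m h g (t - s) := by
  have h1 := H.mulVec_eq (t - s)
  rw [sub_add_cancel] at h1
  have h2 : herm (mat (γ * g) *ᵥ emb 0) (ζ • (mat (h * flow n t) *ᵥ emb 0)) =
      herm (mat g *ᵥ emb 0) (mat (h * flow n (t - s)) *ᵥ emb 0) := by
    rw [← h1, mat_mul, ← mulVec_mulVec, herm_mulVec (preservesForm_mat γ)]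
  rw [herm_smul_right] at h2
  rw [geodesicKernel, geodesicKernel, ← h2, mul_pow, ← star_pow, H.pow_eq, star_one, one_mul]

theorem TranslatesGeodesic.geodesicKernel_zpow_mul {m : ℕ} {γ h : SU n} {s : ℝ} {ζ : ℂ}
    (H : TranslatesGeodesic m γ h s ζ) (k : ℤ) (g : SU n) (t : ℝ) :
    geodesicKernel m h (γ ^ k * g) t = geodesicKernel m h g (t - k * s) := by
  induction k generalizing g t with
  | zero => simp
  | succ k ih =>
    rw [_root_.zpow_add_one, mul_assoc, ih, H.geodesicKernel_mul]
    congr 1; push_cast; ring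
  | pred k ih =>
    rw [_root_.zpow_sub_one, mul_assoc, ih]
    have := H.geodesicKernel_mul (γ⁻¹ * g) (t - ((-(k : ℤ) : ℤ) : ℝ) * s + s)
    rw [mul_inv_cancel_left, add_sub_cancel_right] at this
    rw [← this]
    congr 1; push_cast; ring

/-- The integral of the kernel over one period. -/
noncomputable def periodKernel (m : ℕ) (h : SU n) (s : ℝ) (g : SU n) : ℂ :=
  ∫ t in Set.Ioc 0 |s|, geodesicKernel m h g t

theorem TranslatesGeodesic.hasSum_periodKernel {m : ℕ} (hm : 1 ≤ m) {γ h : SU n} {s : ℝ} {ζ : ℂ}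
    (hs : s ≠ 0) (H : TranslatesGeodesic m γ h s ζ) (g : SU n) :
    HasSum (fun k : ℤ => periodKernel m h s (γ ^ k * g)) (∫ t, geodesicKernel m h g t) := by
  simp only [periodKernel, H.geodesicKernel_zpow_mul]
  exact hasSum_setIntegral_Ioc_sub_zsmul hs (integrable_geodesicKernel hm h g)

variable {μ : Measure (SU n)} [μ.IsHaarMeasure]
  (hμ : Measure.map (fun g : SU n => act g 0) μ = hypVolume n) {m : ℕ} (hm : n + 1 ≤ m)

include hμ hm

theorem integrable_prod_geodesicKernel (h : SU n) (s : ℝ) :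
    Integrable (fun p : SU n × ℝ => geodesicKernel m h p.1 p.2)
      (μ.prod (volume.restrict (Set.Ioc 0 |s|))) := by
  have := sigmaFinite_of_map_act hμ
  have hmeas : AEStronglyMeasurable (fun p : SU n × ℝ => geodesicKernel m h p.1 p.2)
      (μ.prod (volume.restrict (Set.Ioc 0 |s|))) :=
    (continuous_geodesicKernel m h).aestronglyMeasurable
  rw [integrable_prod_iff' hmeas]
  have hk : ∀ t, Integrable (fun g => geodesicKernel m h g t) μ := fun t => by
    simp only [geodesicKernel]
    exact integrable_herm_pow_inv hμ hm _
  have hn : ∀ t, ∫ g, ‖geodesicKernel m h g t‖ ∂μ = ∫ g, ‖j g 0 ^ (2 * m)‖ ∂μ := fun t => by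
    simp only [geodesicKernel]
    exact integral_norm_herm_pow_inv m _
  refine ⟨Filter.Eventually.of_forall hk, ?_⟩
  simp only [hn]
  exact integrable_const _

theorem integrable_periodKernel (h : SU n) (s : ℝ) : Integrable (periodKernel m h s) μ := by
  have := sigmaFinite_of_map_act hμ
  exact (integrable_prod_geodesicKernel hμ hm h s).integral_prod_left

theorem integrable_lift_mul_star_periodKernel (h : SU n) (s : ℝ) {f : (Fin n → ℂ) → ℂ}
    (hf : DifferentiableOn ℂ f (ball n)) {M : ℝ} (hM : ∀ g, ‖lift m f g‖ ≤ M) :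
    Integrable (fun g => lift m f g * star (periodKernel m h s g)) μ :=
  (integrable_star (integrable_periodKernel hμ hm h s)).bdd_mul (c := M)
    (continuous_lift m hf.continuousOn).aestronglyMeasurable (Filter.Eventually.of_forall hM)

/-- Fubini, then the reproducing property at each point `h a_t`. -/
theorem integral_lift_mul_star_periodKernel (h : SU n) (s : ℝ) {f : (Fin n → ℂ) → ℂ}
    (hf : DifferentiableOn ℂ f (ball n)) {M : ℝ} (hM : ∀ g, ‖lift m f g‖ ≤ M) :
    ∫ g, lift m f g * star (periodKernel m h s g) ∂μ =
      (4 ^ n * Real.pi ^ n * (2 * m - n - 1)! / (2 * m - 1)! : ℝ) *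
        ∫ t in Set.Ioc 0 |s|, lift m f (h * flow n t) := by
  have := sigmaFinite_of_map_act hμ
  have hint : Integrable (Function.uncurry fun (g : SU n) (t : ℝ) =>
      lift m f g * star (geodesicKernel m h g t)) (μ.prod (volume.restrict (Set.Ioc 0 |s|))) :=
    (integrable_star (integrable_prod_geodesicKernel hμ hm h s)).bdd_mul (c := M)
      ((continuous_lift m hf.continuousOn).comp continuous_fst).aestronglyMeasurable
      (Filter.Eventually.of_forall fun p => hM p.1)
  have h1 : ∀ g, lift m f g * star (periodKernel m h s g) =
      ∫ t in Set.Ioc 0 |s|, lift m f g * star (geodesicKernel m h g t) := by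
    intro g
    rw [integral_const_mul, periodKernel, Complex.star_def, ← integral_conj]
  simp only [h1]
  rw [integral_integral_swap hint, ← integral_const_mul]
  refine integral_congr_ae (Filter.Eventually.of_forall fun t => ?_)
  simp only [geodesicKernel]
  rw [integral_lift_mul_star_herm_pow_inv hμ hm hf hM, mul_comm]

end Kernel

/-! ### The relative Poincaré series and its Petersson products -/

section Poincare

variable {n : ℕ}

/-- For a null vector the first `n` coordinates have Euclidean norm `|v_{n+1}|`, so Cauchy–Schwarz
bounds the pairing from both sides by multiples of the same number. -/
theorem norm_herm_emb_le {z : Fin n → ℂ} (hz : z ∈ ball n) {v : Fin n ⊕ Unit → ℂ}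
    (hv : herm v v = 0) :
    ‖herm (emb z) v‖ ≤ 2 * ‖v (Sum.inr ())‖ ∧
      (1 - √(∑ i, ‖z i‖ ^ 2)) * ‖v (Sum.inr ())‖ ≤ ‖herm (emb z) v‖ := by
  rw [herm_self, Complex.ofReal_eq_zero, sub_eq_zero] at hv
  have h1 : ‖∑ i, z i * star (v (Sum.inl i))‖ ≤ √(∑ i, ‖z i‖ ^ 2) * ‖v (Sum.inr ())‖ := by
    refine (norm_sum_le _ _).trans ?_
    simp only [norm_mul, norm_star]
    refine (Real.sum_mul_le_sqrt_mul_sqrt _ _ _).trans ?_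
    rw [hv, Real.sqrt_sq (norm_nonneg _)]
  have h2 : √(∑ i, ‖z i‖ ^ 2) ≤ 1 := Real.sqrt_le_one.2 (le_of_lt hz)
  have h3 : herm (emb z) v = ∑ i, z i * star (v (Sum.inl i)) - star (v (Sum.inr ())) := by
    simp [herm, emb]
  have h4 := norm_nonneg (v (Sum.inr ()))
  rw [h3]
  constructor
  · refine (norm_sub_le _ _).trans ?_
    rw [norm_star]
    nlinarith
  · have := norm_sub_norm_le (star (v (Sum.inr ()))) (∑ i, z i * star (v (Sum.inl i)))
    rw [norm_star, norm_sub_rev] at this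
    linarith

/-- A Harnack inequality: a null vector cannot distinguish two points of the ball. -/
theorem exists_norm_herm_emb_le (z₀ : Fin n → ℂ) (hz₀ : z₀ ∈ ball n) (z : Fin n → ℂ)
    (hz : z ∈ ball n) :
    ∃ K : ℝ, 0 ≤ K ∧ ∀ v : Fin n ⊕ Unit → ℂ, herm v v = 0 →
      ‖herm (emb z₀) v‖ ≤ K * ‖herm (emb z) v‖ := by
  have h1 : √(∑ i, ‖z i‖ ^ 2) < 1 := by
    rw [Real.sqrt_lt' one_pos, one_pow]; exact hz
  refine ⟨2 / (1 - √(∑ i, ‖z i‖ ^ 2)), div_nonneg zero_le_two (by linarith), fun v hv => ?_⟩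
  rw [div_mul_eq_mul_div, le_div_iff₀ (by linarith)]
  have h2 := (norm_herm_emb_le hz₀ hv).1
  have h3 := (norm_herm_emb_le hz hv).2
  nlinarith

/-- Each term pairs `(z,1)` with the null vectors `γ⁻¹X` and `γ⁻¹Y`, so the Harnack constant
compares terms at `z` and `z₀` uniformly in the coset. Nonvanishing at `z₀` excludes a spurious `0⁻¹
= 0`, which would bound nothing. -/
theorem summable_thetaTerm_of_summable {Γ : Subgroup (SU n)} (γ₀ : Γ) {X Y : Fin n ⊕ Unit → ℂ}
    (hX : herm X X = 0) (hY : herm Y Y = 0) (m : ℕ) {z₀ : Fin n → ℂ} (hz₀ : z₀ ∈ ball n)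
    (h : Summable (thetaTerm γ₀ X Y m z₀)) (h0 : ∀ c, thetaTerm γ₀ X Y m z₀ c ≠ 0)
    {z : Fin n → ℂ} (hz : z ∈ ball n) :
    Summable (thetaTerm γ₀ X Y m z) := by
  obtain ⟨K, hK0, hK⟩ := exists_norm_herm_emb_le z₀ hz₀ z hz
  refine Summable.of_norm_bounded (g := fun c => (K ^ 2) ^ m * ‖thetaTerm γ₀ X Y m z₀ c‖)
    (h.norm.mul_left _) fun c => ?_
  have hnull : ∀ (g : SU n) (v : Fin n ⊕ Unit → ℂ), herm v v = 0 →
      herm (mat g *ᵥ v) (mat g *ᵥ v) = 0 := fun g v hv => by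
    rw [herm_mulVec (preservesForm_mat g), hv]
  have h00 := h0 c
  rw [thetaTerm, slash_qForm _ _ _ _ hz₀, ne_eq, inv_eq_zero, ← ne_eq] at h00
  rw [thetaTerm, thetaTerm, slash_qForm _ _ _ _ hz, slash_qForm _ _ _ _ hz₀]
  simp only [herm_mat_mulVec] at h00 ⊢
  have hx := hK _ (hnull (Quotient.out c : Γ).1⁻¹ X hX)
  have hy := hK _ (hnull (Quotient.out c : Γ).1⁻¹ Y hY)
  generalize mat ((Quotient.out c : Γ).1)⁻¹ *ᵥ X = X' at *
  generalize mat ((Quotient.out c : Γ).1)⁻¹ *ᵥ Y = Y' at *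
  have hle : ‖herm (emb z₀) X' * herm (emb z₀) Y'‖ ≤
      K ^ 2 * ‖herm (emb z) X' * herm (emb z) Y'‖ := by
    rw [norm_mul, norm_mul]
    calc _ ≤ (K * ‖herm (emb z) X'‖) * (K * ‖herm (emb z) Y'‖) := by gcongr
      _ = _ := by ring
  have hle2 := pow_le_pow_left₀ (norm_nonneg _) hle m
  rw [mul_pow, ← norm_pow, ← norm_pow] at hle2
  have hp := norm_pos_iff.2 h00
  have hp2 : 0 < ‖(herm (emb z) X' * herm (emb z) Y') ^ m‖ := by
    by_contra hcon
    have := le_antisymm (not_lt.1 hcon) (norm_nonneg _)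
    rw [this, mul_zero] at hle2
    linarith
  rw [norm_inv, norm_inv, ← div_eq_mul_inv, le_div_iff₀ hp, inv_mul_le_iff₀ hp2]
  exact hle2.trans_eq (mul_comm _ _)

theorem lift_thetaTerm {Γ : Subgroup (SU n)} (γ₀ : Γ) (X Y : Fin n ⊕ Unit → ℂ) (m : ℕ)
    (g : SU n) (c : CyclicCosets γ₀) :
    thetaTerm γ₀ X Y m (act g 0) c * j g 0 ^ (2 * m) =
      lift m (qForm X Y m) ((Quotient.out c : Γ) * g) := by
  rw [lift_mul]; rfl

theorem lift_theta {Γ : Subgroup (SU n)} (γ₀ : Γ) (X Y : Fin n ⊕ Unit → ℂ) (m : ℕ) (g : SU n) :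
    lift m (theta γ₀ X Y m) g =
      ∑' c : CyclicCosets γ₀, lift m (qForm X Y m) ((Quotient.out c : Γ) * g) := by
  simp only [lift, theta, ← tsum_mul_right]
  exact tsum_congr fun c => lift_thetaTerm γ₀ X Y m g c

theorem countable_of_isLattice {μ : Measure (SU n)} (hΓ : IsLattice Γ μ) : Countable Γ := by
  have := hΓ.discrete
  exact countable_of_Lindelof_of_discrete

variable [NeZero n] {X Y : Fin n ⊕ Unit → ℂ} {m : ℕ} {h : SU n} {c : ℂ}

theorem lift_qForm_eq_integral (hm : 1 ≤ m)
    (hc : ∀ v, herm v X * herm v Y =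
      c * (herm v (mat h *ᵥ nullPlus n) * herm v (mat h *ᵥ nullMinus n))) (g : SU n) :
    lift m (qForm X Y m) g = (c ^ m * coshConst m)⁻¹ * ∫ t, geodesicKernel m h g t := by
  rw [lift_qForm, hc, integral_geodesicKernel hm, mul_pow]
  have : (coshConst m : ℂ) ≠ 0 := Complex.ofReal_ne_zero.2 (coshConst_ne_zero m)
  field_simp

theorem lift_qForm_ne_zero (hc0 : c ≠ 0)
    (hc : ∀ v, herm v X * herm v Y =
      c * (herm v (mat h *ᵥ nullPlus n) * herm v (mat h *ᵥ nullMinus n))) (g : SU n) :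
    lift m (qForm X Y m) g ≠ 0 := by
  rw [lift_qForm, hc]
  exact inv_ne_zero (pow_ne_zero _ (mul_ne_zero hc0
    (mul_ne_zero (herm_nullPlus_ne_zero g h) (herm_nullMinus_ne_zero g h))))

/-- The factors `e^s` and `e^{-s}` cancel in the product of the two pairings, so invariance of `q`
at the single point `0` already says that the conjugate of `ζ^{2m}` is `1`. -/
theorem translatesGeodesic_of_eigen (hc0 : c ≠ 0)
    (hc : ∀ v, herm v X * herm v Y =
      c * (herm v (mat h *ᵥ nullPlus n) * herm v (mat h *ᵥ nullMinus n)))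
    {γ : SU n} (hq : slash m (qForm X Y m) γ 0 = qForm X Y m 0) {ζ : ℂ} {s : ℝ}
    (hP : mat γ *ᵥ (mat h *ᵥ nullPlus n) = (ζ * Complex.exp s) • (mat h *ᵥ nullPlus n))
    (hQ : mat γ *ᵥ (mat h *ᵥ nullMinus n) = (ζ * Complex.exp (-s)) • (mat h *ᵥ nullMinus n)) :
    TranslatesGeodesic m γ h s ζ where
  pow_eq := by
    have hq1 : lift m (qForm X Y m) (γ * 1) = lift m (qForm X Y m) 1 := by
      rw [lift_mul, lift_one, lift_one, hq]
    rw [mul_one, lift_qForm, lift_qForm, _root_.inv_inj, hc, hc, mul_pow c, mul_pow c] at hq1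
    have hq2 := mul_left_cancel₀ (pow_ne_zero m hc0) hq1
    have e1 := herm_mulVec (preservesForm_mat γ) (mat 1 *ᵥ emb 0) (mat h *ᵥ nullPlus n)
    have e2 := herm_mulVec (preservesForm_mat γ) (mat 1 *ᵥ emb 0) (mat h *ᵥ nullMinus n)
    have n1 := herm_nullPlus_ne_zero 1 h
    have n2 := herm_nullMinus_ne_zero 1 h
    have hexp : star (Complex.exp s) * star (Complex.exp (-s)) = 1 := by
      rw [← star_mul', ← Complex.exp_add]; simp
    rw [hP, herm_smul_right, star_mul'] at e1
    rw [hQ, herm_smul_right, star_mul'] at e2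
    rw [mat_one, one_mulVec] at e1 e2 n1 n2 hq2
    generalize herm (mat γ *ᵥ emb 0) (mat h *ᵥ nullPlus n) = A at *
    generalize herm (mat γ *ᵥ emb 0) (mat h *ᵥ nullMinus n) = B at *
    rw [← e1, ← e2] at hq2
    have hAB : A * B ≠ 0 := by
      refine mul_ne_zero ?_ ?_
      · rintro rfl; exact n1 (by rw [← e1, mul_zero])
      · rintro rfl; exact n2 (by rw [← e2, mul_zero])
    -- `A` and `B` are the pairings at `γe`; those at `e` are `A`, `B` times the conjugate
    -- eigenvalues.
    have e3 : star ζ * star (Complex.exp s) * A * (star ζ * star (Complex.exp (-s)) * B) =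
        star ζ ^ 2 * (A * B) := by
      linear_combination (star ζ ^ 2 * A * B) * hexp
    rw [e3, mul_pow (star ζ ^ 2), eq_comm, mul_eq_right₀ (pow_ne_zero _ hAB), ← pow_mul, ← star_pow] at hq2
    rw [← star_star (ζ ^ (2 * m)), hq2, star_one]
  mulVec_eq t := by
    rw [mat_mul_flow_mulVec, mat_mul_flow_mulVec, mulVec_add, mulVec_smul, mulVec_smul, hP, hQ,
      smul_add, smul_smul, smul_smul, smul_smul, smul_smul]
    push_cast
    rw [neg_add, Complex.exp_add, Complex.exp_add]
    congr 2 <;> ring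

variable {Γ : Subgroup (SU n)} {γ₀ : Γ} {s : ℝ} {ζ : ℂ}

/-- Grouping `Γ` by cosets of `⟨γ₀⟩`, the periods within one coset add up to the integral over the
whole line, which is the lift of `q`. -/
theorem hasSum_lift_qForm (hm : 1 ≤ m)
    (hc : ∀ v, herm v X * herm v Y =
      c * (herm v (mat h *ᵥ nullPlus n) * herm v (mat h *ᵥ nullMinus n)))
    (hinj : Function.Injective fun k : ℤ => γ₀ ^ k) (hs : s ≠ 0)
    (H : TranslatesGeodesic m (γ₀ : SU n) h s ζ) {g : SU n}
    (hg : Summable fun γ : Γ => periodKernel m h s (γ • g)) :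
    HasSum (fun a : CyclicCosets γ₀ => lift m (qForm X Y m) ((Quotient.out a : Γ) * g))
      ((c ^ m * coshConst m)⁻¹ * ∑' γ : Γ, periodKernel m h s (γ • g)) := by
  simp only [lift_qForm_eq_integral hm hc]
  refine (hasSum_cosets hinj hg fun a => ?_).mul_left _
  have := H.hasSum_periodKernel hm hs ((Quotient.out a : Γ) * g)
  simpa [Subgroup.smul_def, mul_assoc] using this

/-- The analytic core. Only the product of the two pairings enters `hc`, so the ends of the geodesic
of `h` may be `X` and `Y` in either order, and `s` may have either sign. -/
theorem petersson_theta_of_translatesGeodesic {μ : Measure (SU n)} [μ.IsHaarMeasure]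
    (hμ : Measure.map (fun g : SU n => act g 0) μ = hypVolume n) (hm : n + 1 ≤ m)
    (hΓ : IsLattice Γ μ) {D : Set (SU n)} (hD : IsFundamentalDomain Γ D μ)
    {f : (Fin n → ℂ) → ℂ} (hf : IsCuspForm Γ m f) (hX : herm X X = 0) (hY : herm Y Y = 0)
    (hc0 : c ≠ 0)
    (hc : ∀ v, herm v X * herm v Y =
      c * (herm v (mat h *ᵥ nullPlus n) * herm v (mat h *ᵥ nullMinus n)))
    (hinj : Function.Injective fun k : ℤ => γ₀ ^ k) (hs : s ≠ 0)
    (H : TranslatesGeodesic m (γ₀ : SU n) h s ζ) :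
    (∀ z ∈ ball n, Summable (thetaTerm γ₀ X Y m z)) ∧
    IntegrableOn (peterssonIntegrand m f (theta γ₀ X Y m)) D μ ∧
    petersson μ D m f (theta γ₀ X Y m) = star ((c ^ m * coshConst m)⁻¹) *
      ((4 ^ n * Real.pi ^ n * (2 * m - n - 1)! / (2 * m - 1)! : ℝ) *
        ∫ t in Set.Ioc 0 |s|, lift m f (h * flow n t)) := by
  have := countable_of_isLattice hΓ
  obtain ⟨M, hM⟩ := hf.bounded
  have hm1 : 1 ≤ m := by omega
  have hK := integrable_periodKernel hμ hm h s
  have hF := integrable_lift_mul_star_periodKernel hμ hm h s hf.holo hM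
  have hsum := ae_summable_smul hD hK
  refine ⟨?_, ?_⟩
  · have hD0 : μ.restrict D ≠ 0 := by
      rw [Ne, Measure.restrict_eq_zero]
      exact hD.measure_ne_zero (NeZero.ne μ)
    have : (ae (μ.restrict D)).NeBot := ae_neBot.2 hD0
    obtain ⟨g, hg⟩ := hsum.exists
    have h1 := (hasSum_lift_qForm hm1 hc hinj hs H hg).summable
    have hj : j g 0 ^ (2 * m) ≠ 0 := pow_ne_zero _ (inv_ne_zero (denom_ne_zero g zero_mem_ball))
    have h2 : Summable (thetaTerm γ₀ X Y m (act g 0)) := by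
      simp only [← lift_thetaTerm] at h1
      exact (summable_mul_right_iff hj).1 h1
    refine fun z hz => summable_thetaTerm_of_summable γ₀ hX hY m (act_mem_ball g zero_mem_ball) h2
      (fun a ha => ?_) hz
    have := lift_thetaTerm γ₀ X Y m g a
    rw [ha, zero_mul] at this
    exact lift_qForm_ne_zero hc0 hc _ this.symm
  · have hae : peterssonIntegrand m f (theta γ₀ X Y m) =ᵐ[μ.restrict D] fun g =>
        star ((c ^ m * coshConst m)⁻¹) *
          ∑' γ : Γ, lift m f (γ • g) * star (periodKernel m h s (γ • g)) := by
      filter_upwards [hsum] with g hg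
      -- `f̃` is constant on `Γ`-orbits and can be carried inside the sum.
      have h1 : ∀ γ : Γ, lift m f (γ • g) = lift m f g := fun γ => hf.lift_mul_left γ.2 g
      simp only [h1]
      rw [peterssonIntegrand, lift_theta, (hasSum_lift_qForm hm1 hc hinj hs H hg).tsum_eq,
        star_mul', tsum_mul_left, ← tsum_star]
      ring
    have hi := (integrableOn_tsum_smul hD hF).const_mul (star ((c ^ m * coshConst m)⁻¹))
    refine ⟨hi.congr hae.symm, ?_⟩
    rw [petersson, integral_congr_ae hae, integral_const_mul, setIntegral_tsum_smul hD hF,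
      integral_lift_mul_star_periodKernel hμ hm h s hf.holo hM]

end Poincare

/-! ### Loxodromic elements, axes and lifts of closed geodesics -/

section Axis

variable {n : ℕ}

/-- In signature `(n,1)` isotropic subspaces are lines: subtracting the multiple of `X` with the
same last coordinate leaves a null vector with last coordinate `0`, hence zero. -/
theorem eq_smul_of_herm_eq_zero {v X : Fin n ⊕ Unit → ℂ} (hv : herm v v = 0) (hX : herm X X = 0)
    (hX0 : X ≠ 0) (h : herm v X = 0) : ∃ a : ℂ, v = a • X := by
  have hzero : ∀ N : Fin n ⊕ Unit → ℂ, herm N N = 0 → N (Sum.inr ()) = 0 → N = 0 := by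
    intro N hN hl
    rw [herm_self, Complex.ofReal_eq_zero, hl, norm_zero, zero_pow two_ne_zero, sub_zero,
      Finset.sum_eq_zero_iff_of_nonneg fun _ _ => by positivity] at hN
    ext (i | i)
    · simpa using hN i (Finset.mem_univ i)
    · simpa using hl
  have hXl : X (Sum.inr ()) ≠ 0 := fun hl => hX0 (hzero X hX hl)
  refine ⟨v (Sum.inr ()) / X (Sum.inr ()), ?_⟩
  rw [← sub_eq_zero]
  refine hzero _ ?_ ?_
  · have h' : herm X v = 0 := by rw [← star_herm, h, star_zero]
    rw [sub_eq_add_neg, ← neg_smul]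
    simp only [herm_add_left, herm_add_right, herm_smul_left, herm_smul_right, hv, hX, h, h']
    simp
  · simp [div_mul_cancel₀ _ hXl]

theorem IsAttracting.ne_zero {γ : SU n} {X : Fin n ⊕ Unit → ℂ} (hX : IsAttracting γ X) :
    X ≠ 0 := by
  rintro rfl
  simpa using hX.last

/-- Invariance of the form multiplies `⟨v,X⟩` by a number of modulus greater than `1`, so it
vanishes, and orthogonal null vectors are parallel. -/
theorem IsAttracting.eq_smul_of_eigen {γ : SU n} {X v : Fin n ⊕ Unit → ℂ} (hX : IsAttracting γ X)
    (hv : herm v v = 0) {a : ℂ} (ha : 1 < ‖a‖) (hav : mat γ *ᵥ v = a • v) :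
    ∃ b : ℂ, v = b • X := by
  obtain ⟨l, hl, hlX⟩ := hX.eigen
  refine eq_smul_of_herm_eq_zero hv hX.null hX.ne_zero ?_
  have h := herm_mulVec (preservesForm_mat γ) v X
  rw [hav, hlX, herm_smul_left, herm_smul_right, ← mul_assoc] at h
  by_contra h0
  have h1 := (mul_eq_right₀ h0).1 h
  have h2 : ‖a * star l‖ = 1 := by rw [h1, norm_one]
  rw [norm_mul, norm_star] at h2
  nlinarith

theorem mat_inv_mulVec_of_eigen {γ : SU n} {v : Fin n ⊕ Unit → ℂ} {a : ℂ} (ha : a ≠ 0)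
    (hav : mat γ *ᵥ v = a • v) : mat γ⁻¹ *ᵥ v = a⁻¹ • v := by
  have h := mat_inv_mulVec_mat_mulVec γ v
  rw [hav, mulVec_smul] at h
  rw [← h, smul_smul, inv_mul_cancel₀ ha, one_smul, h]

theorem IsRepelling.eigen_inv {γ : SU n} {Y : Fin n ⊕ Unit → ℂ} (hY : IsRepelling γ Y) :
    ∃ l : ℂ, mat γ *ᵥ Y = l • Y := by
  obtain ⟨l, hl, hlY⟩ := IsAttracting.eigen hY
  have hl0 : l ≠ 0 := by rintro rfl; simp at hl; linarith
  exact ⟨l⁻¹, by simpa using mat_inv_mulVec_of_eigen hl0 hlY⟩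

theorem mat_pow_mulVec_of_eigen {γ : SU n} {v : Fin n ⊕ Unit → ℂ} {a : ℂ}
    (hav : mat γ *ᵥ v = a • v) (k : ℕ) : mat (γ ^ k) *ᵥ v = a ^ k • v := by
  induction k with
  | zero => simp [mat_one]
  | succ k ih => rw [pow_succ, mat_mul, ← mulVec_mulVec, hav, mulVec_smul, ih, smul_smul, pow_succ']

theorem IsAttracting.injective_zpow {Γ : Subgroup (SU n)} {γ₀ : Γ} {X : Fin n ⊕ Unit → ℂ}
    (hX : IsAttracting (γ₀ : SU n) X) : Function.Injective fun k : ℤ => γ₀ ^ k := by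
  rw [injective_zpow_iff_not_isOfFinOrder, isOfFinOrder_iff_pow_eq_one]
  rintro ⟨k, hk, h1⟩
  obtain ⟨l, hl, hlX⟩ := hX.eigen
  have h2 := mat_pow_mulVec_of_eigen hlX k
  rw [← Subgroup.coe_pow, h1, Subgroup.coe_one, mat_one, one_mulVec] at h2
  have h3 := congrFun h2 (Sum.inr ())
  rw [Pi.smul_apply, hX.last, smul_eq_mul, mul_one] at h3
  have h4 : ‖l‖ ^ k = 1 := by rw [← norm_pow, ← h3, norm_one]
  exact (one_lt_pow₀ hl hk.ne').ne' h4

/-- Otherwise `X = Y` by the common normalization, and both `γ` and `γ⁻¹` would expand this vector.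
-/
theorem IsAttracting.herm_ne_zero {γ : SU n} {X Y : Fin n ⊕ Unit → ℂ}
    (hX : IsAttracting γ X) (hY : IsRepelling γ Y) : herm X Y ≠ 0 := by
  intro h0
  obtain ⟨a, ha⟩ := eq_smul_of_herm_eq_zero hX.null hY.null hY.ne_zero h0
  have h1 := congrFun ha (Sum.inr ())
  rw [Pi.smul_apply, hX.last, IsAttracting.last hY, smul_eq_mul, mul_one] at h1
  rw [← h1, one_smul] at ha
  obtain ⟨l, hl, hlX⟩ := hX.eigen
  obtain ⟨k, hk, hkY⟩ := IsAttracting.eigen hY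
  have hk' : mat γ⁻¹ *ᵥ X = k • X := by rw [ha]; exact hkY
  have h2 := mat_inv_mulVec_mat_mulVec γ X
  rw [hlX, mulVec_smul, hk', smul_smul] at h2
  have h3 := congrFun h2 (Sum.inr ())
  rw [Pi.smul_apply, hX.last, smul_eq_mul, mul_one] at h3
  have h4 : ‖l * k‖ = 1 := by rw [h3, norm_one]
  rw [norm_mul] at h4
  nlinarith

/-- The product `⟨·,X⟩⟨·,Y⟩` in terms of a frame whose null vectors are multiples of `X`, `Y`. -/
theorem herm_mul_herm_of_smul {P Q X Y : Fin n ⊕ Unit → ℂ} {a b : ℂ} (hP : P = a • X)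
    (hQ : Q = b • Y) (ha : a ≠ 0) (hb : b ≠ 0) (v : Fin n ⊕ Unit → ℂ) :
    herm v X * herm v Y = star (a * b)⁻¹ * (herm v P * herm v Q) := by
  have h1 : star a ≠ 0 := star_ne_zero.2 ha
  have h2 : star b ≠ 0 := star_ne_zero.2 hb
  rw [hP, hQ, herm_smul_right, herm_smul_right, star_inv₀, star_mul']
  field_simp

variable [NeZero n]

theorem herm_mat_nullPlus_nullPlus (g : SU n) :
    herm (mat g *ᵥ nullPlus n) (mat g *ᵥ nullPlus n) = 0 := by
  rw [herm_mulVec (preservesForm_mat g), herm_nullPlus_right]; simp [nullPlus]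

theorem herm_mat_nullMinus_nullMinus (g : SU n) :
    herm (mat g *ᵥ nullMinus n) (mat g *ᵥ nullMinus n) = 0 := by
  rw [herm_mulVec (preservesForm_mat g), herm_nullMinus_right]; simp [nullMinus]

theorem herm_mat_nullPlus_nullMinus (g : SU n) :
    herm (mat g *ᵥ nullPlus n) (mat g *ᵥ nullMinus n) = -(1 / 2) := by
  rw [herm_mulVec (preservesForm_mat g), herm_nullMinus_right]; simp [nullPlus]

theorem herm_mat_nullMinus_nullPlus (g : SU n) :
    herm (mat g *ᵥ nullMinus n) (mat g *ᵥ nullPlus n) = -(1 / 2) := by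
  rw [← star_herm, herm_mat_nullPlus_nullMinus]; simp

theorem mat_nullPlus_ne_zero (g : SU n) : mat g *ᵥ nullPlus n ≠ 0 := fun h0 => by
  have := herm_mat_nullPlus_nullMinus g
  rw [h0] at this
  simp [herm] at this

theorem mat_nullMinus_ne_zero (g : SU n) : mat g *ᵥ nullMinus n ≠ 0 := fun h0 => by
  have := herm_mat_nullMinus_nullPlus g
  rw [h0] at this
  simp [herm] at this

theorem nullPlus_eq : nullPlus n = (1 / 2 : ℂ) • (Pi.single (Sum.inr ()) 1 + Pi.single (Sum.inl ⊤) 1)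
    := by
  rw [← emb_zero, ← nullPlus_add_nullMinus, ← nullPlus_sub_nullMinus]
  module

theorem nullMinus_eq :
    nullMinus n = (1 / 2 : ℂ) • (Pi.single (Sum.inr ()) 1 - Pi.single (Sum.inl ⊤) 1) := by
  rw [← emb_zero, ← nullPlus_add_nullMinus, ← nullPlus_sub_nullMinus]
  module

theorem IsRotation.mulVec_single_last {ψ : ℝ} {w : Matrix (Fin n ⊕ Unit) (Fin n ⊕ Unit) ℂ}
    (hw : IsRotation ψ w) : w *ᵥ Pi.single (Sum.inr ()) 1 =
      Complex.exp (-(Complex.I * ψ)) • Pi.single (Sum.inr ()) 1 := by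
  ext i
  rw [mulVec_single_one, Matrix.col_apply, hw.col_last]
  simp [Pi.single_apply]

theorem IsRotation.mulVec_single_top {ψ : ℝ} {w : Matrix (Fin n ⊕ Unit) (Fin n ⊕ Unit) ℂ}
    (hw : IsRotation ψ w) : w *ᵥ Pi.single (Sum.inl ⊤) 1 =
      Complex.exp (-(Complex.I * ψ)) • Pi.single (Sum.inl ⊤) 1 := by
  ext i
  rw [mulVec_single_one, Matrix.col_apply, hw.col_n]
  simp [Pi.single_apply]

theorem IsRotation.mulVec_nullPlus {ψ : ℝ} {w : Matrix (Fin n ⊕ Unit) (Fin n ⊕ Unit) ℂ}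
    (hw : IsRotation ψ w) :
    w *ᵥ nullPlus n = Complex.exp (-(Complex.I * ψ)) • nullPlus n := by
  rw [nullPlus_eq, mulVec_smul, mulVec_add, hw.mulVec_single_last, hw.mulVec_single_top]
  module

theorem IsRotation.mulVec_nullMinus {ψ : ℝ} {w : Matrix (Fin n ⊕ Unit) (Fin n ⊕ Unit) ℂ}
    (hw : IsRotation ψ w) :
    w *ᵥ nullMinus n = Complex.exp (-(Complex.I * ψ)) • nullMinus n := by
  rw [nullMinus_eq, mulVec_smul, mulVec_sub, hw.mulVec_single_last, hw.mulVec_single_top]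
  module

/-- The columns come from the sum and difference of the null vectors. The last row then vanishes off
the diagonal by orthogonality, so `w` commutes with the form matrix, and preserving the form becomes
unitarity. -/
theorem isRotation_of_preservesForm {ψ : ℝ} {w : Matrix (Fin n ⊕ Unit) (Fin n ⊕ Unit) ℂ}
    (hw : PreservesForm w)
    (hp : w *ᵥ nullPlus n = Complex.exp (-(Complex.I * ψ)) • nullPlus n)
    (hm : w *ᵥ nullMinus n = Complex.exp (-(Complex.I * ψ)) • nullMinus n) : IsRotation ψ w := by
  have hl : w *ᵥ Pi.single (Sum.inr ()) 1 =
      Complex.exp (-(Complex.I * ψ)) • Pi.single (Sum.inr ()) 1 := by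
    rw [← emb_zero, ← nullPlus_add_nullMinus, mulVec_add, hp, hm, smul_add]
  have hn : w *ᵥ Pi.single (Sum.inl ⊤) 1 =
      Complex.exp (-(Complex.I * ψ)) • Pi.single (Sum.inl ⊤) 1 := by
    rw [← nullPlus_sub_nullMinus, mulVec_sub, hp, hm, smul_sub]
  have hlast : ∀ i, w i (Sum.inr ()) =
      if i = Sum.inr () then Complex.exp (-(Complex.I * ψ)) else 0 := fun i => by
    have := congrFun hl i
    rw [mulVec_single_one, Matrix.col_apply] at this
    rw [this]; simp [Pi.single_apply]
  have htop : ∀ i, w i (Sum.inl ⊤) =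
      if i = Sum.inl ⊤ then Complex.exp (-(Complex.I * ψ)) else 0 := fun i => by
    have := congrFun hn i
    rw [mulVec_single_one, Matrix.col_apply] at this
    rw [this]; simp [Pi.single_apply]
  have hrow : ∀ i, w (Sum.inr ()) (Sum.inl i) = 0 := fun i => by
    have h := herm_mulVec hw (Pi.single (Sum.inl i) 1) (emb 0)
    rw [herm_emb_zero_right, emb_zero, hl, ← emb_zero, herm_smul_right, herm_emb_zero_right,
      mulVec_single_one, Matrix.col_apply] at h
    simpa [Complex.exp_ne_zero] using h
  have hcomm : formMatrix n * w = w * formMatrix n := by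
    have hJ : formMatrix n = Matrix.diagonal (Sum.elim (fun _ => 1) fun _ => -1) := by
      ext (i | i) (k | k) <;> simp [formMatrix, Matrix.diagonal_apply, Matrix.one_apply]
    rw [hJ]
    ext (i | i) (k | k) <;> simp [hrow, hlast]
  have hJJ : formMatrix n * formMatrix n = 1 := by
    simp [formMatrix, Matrix.fromBlocks_multiply]
  refine ⟨?_, htop, hlast⟩
  have h : wᴴ * formMatrix n * w = formMatrix n := hw
  rw [Matrix.mul_assoc, hcomm, ← Matrix.mul_assoc] at h
  have h2 := congrArg (· * formMatrix n) h
  simpa [Matrix.mul_assoc, hJJ] using h2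

/-- This supplies an axis for the convergence claims, which do not presuppose a geodesic lift. -/
theorem exists_frame_of_isLoxodromic {γ : SU n} (hγ : IsLoxodromic γ) {X Y : Fin n ⊕ Unit → ℂ}
    (hX : IsAttracting γ X) (hY : IsRepelling γ Y) :
    ∃ (h : SU n) (s : ℝ) (ζ c : ℂ), s ≠ 0 ∧ c ≠ 0 ∧
      (∀ v, herm v X * herm v Y =
        c * (herm v (mat h *ᵥ nullPlus n) * herm v (mat h *ᵥ nullMinus n))) ∧
      mat γ *ᵥ (mat h *ᵥ nullPlus n) = (ζ * Complex.exp s) • (mat h *ᵥ nullPlus n) ∧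
      mat γ *ᵥ (mat h *ᵥ nullMinus n) = (ζ * Complex.exp (-s)) • (mat h *ᵥ nullMinus n) := by
  obtain ⟨h, s, hs, w, ⟨ψ, hw⟩, hγ⟩ := hγ
  have hγ' : γ * h = h * (flow n s * w) := by rw [← hγ]; group
  have hmul : ∀ v, mat γ *ᵥ (mat h *ᵥ v) = mat h *ᵥ (flowMatrix n s *ᵥ (mat w *ᵥ v)) := fun v => by
    rw [mulVec_mulVec, ← mat_mul, hγ', mat_mul, mat_mul, mat_flow, ← mulVec_mulVec,
      ← mulVec_mulVec]
  set ζ := Complex.exp (-(Complex.I * ψ)) with hζ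
  have hP : mat γ *ᵥ (mat h *ᵥ nullPlus n) = (ζ * Complex.exp s) • (mat h *ᵥ nullPlus n) := by
    rw [hmul, hw.mulVec_nullPlus, mulVec_smul, flowMatrix_mulVec_nullPlus, mulVec_smul,
      mulVec_smul, smul_smul]
  have hQ : mat γ *ᵥ (mat h *ᵥ nullMinus n) =
      (ζ * Complex.exp (-s)) • (mat h *ᵥ nullMinus n) := by
    rw [hmul, hw.mulVec_nullMinus, mulVec_smul, flowMatrix_mulVec_nullMinus, mulVec_smul,
      mulVec_smul, smul_smul]
  have hζn : ‖ζ‖ = 1 := by rw [hζ, Complex.norm_exp]; simp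
  have n1 : ‖ζ * Complex.exp s‖ = Real.exp s := by
    rw [norm_mul, hζn, one_mul, Complex.norm_exp]; simp
  have n2 : ‖ζ * Complex.exp (-s)‖ = Real.exp (-s) := by
    rw [norm_mul, hζn, one_mul, Complex.norm_exp]; simp
  have z1 : ζ * Complex.exp s ≠ 0 := mul_ne_zero (Complex.exp_ne_zero _) (Complex.exp_ne_zero _)
  have z2 : ζ * Complex.exp (-s) ≠ 0 :=
    mul_ne_zero (Complex.exp_ne_zero _) (Complex.exp_ne_zero _)
  have hP0 := herm_mat_nullPlus_nullPlus h
  have hQ0 := herm_mat_nullMinus_nullMinus h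
  have hPn := mat_nullPlus_ne_zero h
  have hQn := mat_nullMinus_ne_zero h
  rcases lt_or_gt_of_ne hs with hs' | hs'
  -- For `s < 0` the two ends exchange roles: `nullMinus` leads to the attracting point.
  · obtain ⟨a, ha⟩ := hX.eq_smul_of_eigen hQ0 (by rw [n2]; simpa using hs') hQ
    obtain ⟨b, hb⟩ := IsAttracting.eq_smul_of_eigen hY hP0
      (by rw [norm_inv, n1, ← Real.exp_neg]; simpa using hs') (mat_inv_mulVec_of_eigen z1 hP)
    have ha0 : a ≠ 0 := by rintro rfl; exact hQn (by rw [ha, zero_smul])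
    have hb0 : b ≠ 0 := by rintro rfl; exact hPn (by rw [hb, zero_smul])
    refine ⟨h, s, ζ, star (a * b)⁻¹, hs, star_ne_zero.2 (inv_ne_zero (mul_ne_zero ha0 hb0)),
      fun v => ?_, hP, hQ⟩
    rw [herm_mul_herm_of_smul ha hb ha0 hb0, mul_comm (herm v (mat h *ᵥ nullPlus n))]
  · obtain ⟨a, ha⟩ := hX.eq_smul_of_eigen hP0 (by rw [n1]; simpa using hs') hP
    obtain ⟨b, hb⟩ := IsAttracting.eq_smul_of_eigen hY hQ0
      (by rw [norm_inv, n2, ← Real.exp_neg]; simpa using hs') (mat_inv_mulVec_of_eigen z2 hQ)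
    have ha0 : a ≠ 0 := by rintro rfl; exact hPn (by rw [ha, zero_smul])
    have hb0 : b ≠ 0 := by rintro rfl; exact hQn (by rw [hb, zero_smul])
    exact ⟨h, s, ζ, star (a * b)⁻¹, hs, star_ne_zero.2 (inv_ne_zero (mul_ne_zero ha0 hb0)),
      herm_mul_herm_of_smul ha hb ha0 hb0, hP, hQ⟩

end Axis

/-! ### Geodesic lifts compared with the reference frame -/

section Lifts

variable {n : ℕ}

theorem exists_mulVec_eq_smul_of_act_eq {g₁ g₂ : SU n} (h : act g₁ 0 = act g₂ 0) :
    ∃ ζ : ℂ, mat g₁ *ᵥ emb 0 = ζ • (mat g₂ *ᵥ emb 0) := by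
  refine ⟨denom g₁ 0 / denom g₂ 0, ?_⟩
  rw [mat_mulVec_emb g₁ zero_mem_ball, mat_mulVec_emb g₂ zero_mem_ball, h, smul_smul,
    div_mul_cancel₀ _ (denom_ne_zero g₂ zero_mem_ball)]

theorem preservesForm_mul {A B : Matrix (Fin n ⊕ Unit) (Fin n ⊕ Unit) ℂ} (hA : PreservesForm A)
    (hB : PreservesForm B) : PreservesForm (A * B) := by
  have hA' : Aᴴ * formMatrix n * A = formMatrix n := hA
  have hB' : Bᴴ * formMatrix n * B = formMatrix n := hB
  rw [PreservesForm, conjTranspose_mul]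
  calc Bᴴ * Aᴴ * formMatrix n * (A * B) = Bᴴ * (Aᴴ * formMatrix n * A) * B := by
        simp only [Matrix.mul_assoc]
    _ = formMatrix n := by rw [hA', hB']

theorem PreservesForm.isUnit_det {A : Matrix (Fin n ⊕ Unit) (Fin n ⊕ Unit) ℂ}
    (hA : PreservesForm A) : IsUnit A.det := by
  have h := congrArg Matrix.det (show Aᴴ * formMatrix n * A = formMatrix n from hA)
  rw [det_mul] at h
  refine isUnit_iff_ne_zero.2 fun h0 => ?_
  rw [h0, mul_zero] at h
  have : (formMatrix n).det ≠ 0 := by simp [formMatrix]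
  exact this h.symm

theorem PreservesForm.inv {A : Matrix (Fin n ⊕ Unit) (Fin n ⊕ Unit) ℂ} (hA : PreservesForm A) :
    PreservesForm A⁻¹ := by
  have h1 := Matrix.mul_nonsing_inv A hA.isUnit_det
  have h2 := congrArg conjTranspose h1
  rw [conjTranspose_mul, conjTranspose_one] at h2
  have hA' : Aᴴ * formMatrix n * A = formMatrix n := hA
  rw [PreservesForm]
  calc A⁻¹ᴴ * formMatrix n * A⁻¹ = A⁻¹ᴴ * (Aᴴ * formMatrix n * A) * A⁻¹ := by rw [hA']
    _ = (A⁻¹ᴴ * Aᴴ) * formMatrix n * (A * A⁻¹) := by simp only [Matrix.mul_assoc]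
    _ = formMatrix n := by rw [h1, h2, Matrix.one_mul, Matrix.mul_one]

/-- The factor `(2m-1)!` from the ball integral cancels against the one in `coshConst`, which leaves
`periodConst`. -/
theorem petersson_const (n m : ℕ) (ω : ℂ) (ψ : ℝ) :
    ((4 * (-ω / 2) * Complex.exp (2 * Complex.I * ψ)) ^ m * (coshConst m : ℂ))⁻¹ *
        ((4 ^ n * Real.pi ^ n * (2 * m - n - 1)! / (2 * m - 1)! : ℝ) : ℂ) =
      Complex.exp (-(2 * m * Complex.I * ψ)) * ((-ω / 2) ^ m)⁻¹ * (periodConst n m : ℂ) := by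
  have h1 : Complex.exp (-(2 * m * Complex.I * ψ)) =
      (Complex.exp (2 * Complex.I * ψ) ^ m)⁻¹ := by
    rw [← Complex.exp_nat_mul, ← Complex.exp_neg]
    congr 1; ring
  have h2 : periodConst n m = (4 ^ m * coshConst m)⁻¹ *
      (4 ^ n * Real.pi ^ n * (2 * m - n - 1)! / (2 * m - 1)!) := by
    have e : (2 : ℝ) ^ (2 * ((n : ℤ) + 1) - 2 * (m : ℤ) - 1) = 2 * 4 ^ n / 4 ^ m := by
      rw [show (2 * ((n : ℤ) + 1) - 2 * (m : ℤ) - 1) = 1 + 2 * (n : ℤ) - 2 * (m : ℤ) by ring,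
        zpow_sub₀ two_ne_zero, zpow_add₀ two_ne_zero, _root_.zpow_mul, _root_.zpow_mul, zpow_natCast,
        zpow_natCast]
      norm_num
    rw [periodConst, e, coshConst]
    have : ((m - 1)! : ℝ) ≠ 0 := by positivity
    field_simp
  rw [h1, h2, mul_pow, mul_pow, mul_inv, mul_inv, mul_inv]
  push_cast
  rw [mul_inv]
  ring

variable [NeZero n] {X Y : Fin n ⊕ Unit → ℂ}
  {T : Matrix (Fin n ⊕ Unit) (Fin n ⊕ Unit) ℂ}

theorem IsReferenceFrame.mulVec_nullPlus (hT : IsReferenceFrame X Y T) :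
    T *ᵥ nullPlus n = (herm X Y)⁻¹ • X := by
  ext i
  rw [nullPlus_eq, mulVec_smul, mulVec_add, mulVec_single_one, mulVec_single_one]
  simp only [Pi.smul_apply, Pi.add_apply, Matrix.col_apply, hT.col_n, hT.col_last, smul_eq_mul]
  ring

theorem IsReferenceFrame.mulVec_nullMinus (hT : IsReferenceFrame X Y T) :
    T *ᵥ nullMinus n = (-(1 / 2) : ℂ) • Y := by
  ext i
  rw [nullMinus_eq, mulVec_smul, mulVec_sub, mulVec_single_one, mulVec_single_one]
  simp only [Pi.smul_apply, Pi.sub_apply, Matrix.col_apply, hT.col_n, hT.col_last, smul_eq_mul]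
  ring

/-- Equality of points of the ball gives equality of vectors only up to a scalar, which at this
stage may depend on `t`. -/
theorem IsGeodesicLift.exists_mulVec_eq {γ g : SU n} {s : ℝ} (H : IsGeodesicLift γ g s) (t : ℝ) :
    ∃ ζ : ℂ, Complex.exp t • (mat γ *ᵥ (mat g *ᵥ nullPlus n)) +
        Complex.exp (-t) • (mat γ *ᵥ (mat g *ᵥ nullMinus n)) =
      ζ • (Complex.exp (t + s) • (mat g *ᵥ nullPlus n) +
        Complex.exp (-(t + s)) • (mat g *ᵥ nullMinus n)) := by
  have h1 := H.2 t
  rw [← act_mul _ _ zero_mem_ball] at h1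
  obtain ⟨ζ, hζ⟩ := exists_mulVec_eq_smul_of_act_eq h1
  refine ⟨ζ, ?_⟩
  rw [mat_mul, ← mulVec_mulVec, mat_mul_flow_mulVec, mat_mul_flow_mulVec, mulVec_add, mulVec_smul,
    mulVec_smul] at hζ
  exact_mod_cast hζ

theorem smul_add_smul_inj {g : SU n} {a b a' b' : ℂ}
    (h : a • (mat g *ᵥ nullPlus n) + b • (mat g *ᵥ nullMinus n) =
      a' • (mat g *ᵥ nullPlus n) + b' • (mat g *ᵥ nullMinus n)) : a = a' ∧ b = b' := by
  have h1 := congrArg (fun v => herm v (mat g *ᵥ nullMinus n)) h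
  have h2 := congrArg (fun v => herm v (mat g *ᵥ nullPlus n)) h
  simp only [herm_add_left, herm_smul_left, herm_mat_nullPlus_nullMinus,
    herm_mat_nullMinus_nullPlus, herm_mat_nullPlus_nullPlus, herm_mat_nullMinus_nullMinus] at h1 h2
  constructor
  · linear_combination (-2) * h1
  · linear_combination (-2) * h2

/-- If `γ` fixes the endpoints of the geodesic of `g`, it scales them by `ζ e^s` and `ζ e^{-s}`. -/
theorem IsGeodesicLift.exists_eigen {γ g : SU n} {s : ℝ} (H : IsGeodesicLift γ g s) {a b : ℂ}
    (hP : mat γ *ᵥ (mat g *ᵥ nullPlus n) = a • (mat g *ᵥ nullPlus n))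
    (hQ : mat γ *ᵥ (mat g *ᵥ nullMinus n) = b • (mat g *ᵥ nullMinus n)) :
    ∃ ζ : ℂ, a = ζ * Complex.exp s ∧ b = ζ * Complex.exp (-s) := by
  obtain ⟨ζ, hζ⟩ := H.exists_mulVec_eq 0
  refine ⟨ζ, ?_⟩
  rw [hP, hQ] at hζ
  refine smul_add_smul_inj (g := g) ?_
  simpa [smul_smul] using hζ

/-- The endpoints of the geodesic of a lift are fixed by `γ`. -/
theorem IsGeodesicLift.mulVec_endpoints {γ g : SU n} {s : ℝ} (H : IsGeodesicLift γ g s) :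
    (∃ a : ℂ, mat γ *ᵥ (mat g *ᵥ nullPlus n) = a • (mat g *ᵥ nullPlus n)) ∧
      ∃ b : ℂ, mat γ *ᵥ (mat g *ᵥ nullMinus n) = b • (mat g *ᵥ nullMinus n) := by
  set P := mat g *ᵥ nullPlus n with hP
  set Q := mat g *ᵥ nullMinus n with hQ
  set U := mat γ *ᵥ P with hU
  set V := mat γ *ᵥ Q with hV
  set x : ℂ := Complex.exp s with hx
  have hx0 : x ≠ 0 := Complex.exp_ne_zero _
  -- With `y = e^t`, pairing with `P` and with `Q` gives two expressions for the unknown scalar;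
  -- eliminating it leaves a polynomial identity in `y²`.
  have key : ∀ y : ℝ, 0 < y →
      x ^ 2 * (y ^ 4 * herm U P + y ^ 2 * herm V P) = y ^ 2 * herm U Q + herm V Q := by
    intro y hy
    obtain ⟨ζ, hζ⟩ := H.exists_mulVec_eq (Real.log y)
    have hy0 : (y : ℂ) ≠ 0 := Complex.ofReal_ne_zero.2 hy.ne'
    have e1 : Complex.exp (Real.log y) = y := by rw [← Complex.ofReal_exp, Real.exp_log hy]
    have h1 := congrArg (fun v => herm v Q) hζ
    have h2 := congrArg (fun v => herm v P) hζ
    simp only [neg_add, Complex.exp_add, Complex.exp_neg, e1] at h1 h2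
    simp only [← hP, ← hQ, ← hU, ← hV, ← hx] at h1 h2
    simp only [herm_add_left, herm_smul_left] at h1 h2
    rw [show herm P Q = _ from herm_mat_nullPlus_nullMinus g,
      show herm Q Q = _ from herm_mat_nullMinus_nullMinus g] at h1
    rw [show herm P P = _ from herm_mat_nullPlus_nullPlus g,
      show herm Q P = _ from herm_mat_nullMinus_nullPlus g] at h2
    field_simp at h1 h2
    refine mul_left_cancel₀ (mul_ne_zero two_ne_zero hx0) ?_
    linear_combination x ^ 2 * (y : ℂ) ^ 2 * h2 - h1
  -- The identity is quadratic in `y²`, so three values determine it. The second divided difference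
  -- at `y² = 1, 4, 9` isolates the leading coefficient; the constant one follows.
  have k1 := key 1 one_pos
  have k2 := key 2 two_pos
  have k3 := key 3 three_pos
  push_cast at k1 k2 k3
  have hx2 : x ^ 2 ≠ 0 := pow_ne_zero 2 hx0
  have hxUP : x ^ 2 * herm U P = 0 := by
    linear_combination (k3 - k2) / 40 - (k2 - k1) / 24
  have hUP : herm U P = 0 := (mul_eq_zero.1 hxUP).resolve_left hx2
  have hVQ : herm V Q = 0 := by
    linear_combination (k2 - k1) / 3 - k1 - 4 * hxUP
  have hPn : P ≠ 0 := mat_nullPlus_ne_zero g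
  have hQn : Q ≠ 0 := mat_nullMinus_ne_zero g
  have hUU : herm U U = 0 := by
    rw [hU, herm_mulVec (preservesForm_mat γ), hP, herm_mat_nullPlus_nullPlus]
  have hVV : herm V V = 0 := by
    rw [hV, herm_mulVec (preservesForm_mat γ), hQ, herm_mat_nullMinus_nullMinus]
  exact ⟨eq_smul_of_herm_eq_zero hUU (herm_mat_nullPlus_nullPlus g) hPn hUP,
    eq_smul_of_herm_eq_zero hVV (herm_mat_nullMinus_nullMinus g) hQn hVQ⟩

/-- The frame `g` sends the null vectors to `pX` and `qY`, where `s > 0` decides which end is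
attracting. Matching with `T a_r` fixes `r` by a modulus and `ψ` by a phase. -/
theorem exists_isRotation_of_isGeodesicLift {γ g : SU n} {s : ℝ} (hX : IsAttracting γ X)
    (hY : IsRepelling γ Y) (hT : IsReferenceFrame X Y T) (H : IsGeodesicLift γ g s) :
    ∃ (r ψ : ℝ) (w : Matrix (Fin n ⊕ Unit) (Fin n ⊕ Unit) ℂ),
      IsRotation ψ w ∧ mat g = T * flowMatrix n r * w := by
  obtain ⟨⟨a, ha⟩, b, hb⟩ := H.mulVec_endpoints
  obtain ⟨ζ, haζ, hbζ⟩ := H.exists_eigen ha hb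
  have hab := herm_mulVec (preservesForm_mat γ) (mat g *ᵥ nullPlus n) (mat g *ᵥ nullMinus n)
  rw [ha, hb, herm_smul_left, herm_smul_right, herm_mat_nullPlus_nullMinus, ← mul_assoc,
    mul_eq_right₀ (by norm_num)] at hab
  -- Invariance of the form makes `a` times the conjugate of `b` equal to `1`, and the real
  -- exponentials cancel in this product.
  have hζ : ‖ζ‖ = 1 := by
    have h1 := congrArg norm hab
    rw [norm_mul, norm_star, haζ, hbζ, norm_mul, norm_mul, Complex.norm_exp, Complex.norm_exp,
      norm_one] at h1
    have h2 : Real.exp s * Real.exp (-s) = 1 := by rw [← Real.exp_add]; simp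
    simp only [Complex.neg_re, Complex.ofReal_re] at h1
    have h3 : ‖ζ‖ ^ 2 = 1 := by linear_combination h1 - ‖ζ‖ ^ 2 * h2
    exact (pow_eq_one_iff_of_nonneg (norm_nonneg _) two_ne_zero).1 h3
  have ha1 : 1 < ‖a‖ := by
    rw [haζ, norm_mul, hζ, one_mul, Complex.norm_exp]; simpa using H.1
  have hb0 : b ≠ 0 := by
    rintro rfl; simp at hab
  have hb1 : 1 < ‖b⁻¹‖ := by
    rw [hbζ, norm_inv, norm_mul, hζ, one_mul, Complex.norm_exp, ← Real.exp_neg]; simpa using H.1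
  obtain ⟨p, hp⟩ := hX.eq_smul_of_eigen (herm_mat_nullPlus_nullPlus g) ha1 ha
  obtain ⟨q, hq⟩ := IsAttracting.eq_smul_of_eigen hY (herm_mat_nullMinus_nullMinus g) hb1
    (mat_inv_mulVec_of_eigen hb0 hb)
  have hpq := herm_mat_nullPlus_nullMinus g
  rw [hp, hq, herm_smul_left, herm_smul_right] at hpq
  have hω := hX.herm_ne_zero hY
  have hp0 : p * herm X Y ≠ 0 := by
    intro h0
    rw [show p * (star q * herm X Y) = p * herm X Y * star q by ring, h0] at hpq
    norm_num at hpq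
  -- `T` sends `nullPlus` to `X/⟨X,Y⟩`, so `p⟨X,Y⟩` is the scalar to be written as `e^r e^{-iψ}`.
  set r := Real.log ‖p * herm X Y‖ with hr
  set ψ := -(p * herm X Y).arg with hψ
  have hpr : p * herm X Y = Complex.exp r * Complex.exp (-(Complex.I * ψ)) := by
    rw [hr, ← Complex.ofReal_exp, Real.exp_log (norm_pos_iff.2 hp0), hψ]
    conv_lhs => rw [← Complex.norm_mul_exp_arg_mul_I (p * herm X Y)]
    push_cast
    congr 2
    ring
  -- The relation `⟨pX, qY⟩ = -1/2` makes `p⟨X,Y⟩` and the conjugate of `-2q` inverse to each other: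
  -- reciprocal moduli, equal phases.
  have hqr : -2 * q = Complex.exp (-r) * Complex.exp (-(Complex.I * ψ)) := by
    have h1 : (p * herm X Y) * star (-2 * q) = 1 := by
      rw [star_mul']
      simp only [star_neg, star_ofNat]
      linear_combination (-2) * hpq
    have h2 : star (p * herm X Y) * (-2 * q) = 1 := by
      have := congrArg star h1
      rwa [star_mul', star_star, star_one] at this
    have h3 : star (p * herm X Y) = Complex.exp r * Complex.exp (Complex.I * ψ) := by
      rw [hpr, star_mul', Complex.star_def, ← Complex.exp_conj, ← Complex.exp_conj]
      simp
    rw [h3] at h2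
    have h4 : Complex.exp r * Complex.exp (Complex.I * ψ) *
        (Complex.exp (-r) * Complex.exp (-(Complex.I * ψ))) = 1 := by
      rw [← Complex.exp_add, ← Complex.exp_add, ← Complex.exp_add, ← Complex.exp_zero]
      congr 1; ring
    exact mul_left_cancel₀ (left_ne_zero_of_mul_eq_one h2) (h2.trans h4.symm)
  have hA := preservesForm_mul hT.form (preservesForm_flowMatrix n r)
  have hAp : (T * flowMatrix n r) *ᵥ nullPlus n = Complex.exp r • (herm X Y)⁻¹ • X := by
    rw [← mulVec_mulVec, flowMatrix_mulVec_nullPlus, mulVec_smul, hT.mulVec_nullPlus]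
  have hAq : (T * flowMatrix n r) *ᵥ nullMinus n = Complex.exp (-r) • (-(1 / 2) : ℂ) • Y := by
    rw [← mulVec_mulVec, flowMatrix_mulVec_nullMinus, mulVec_smul, hT.mulVec_nullMinus]
  have hgp : mat g *ᵥ nullPlus n =
      Complex.exp (-(Complex.I * ψ)) • ((T * flowMatrix n r) *ᵥ nullPlus n) := by
    rw [hAp, hp, smul_smul, smul_smul]
    congr 1
    rw [mul_comm (Complex.exp _), ← hpr, mul_inv_cancel_right₀ hω]
  have hgq : mat g *ᵥ nullMinus n =
      Complex.exp (-(Complex.I * ψ)) • ((T * flowMatrix n r) *ᵥ nullMinus n) := by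
    rw [hAq, hq, smul_smul, smul_smul]
    congr 1
    linear_combination (-(1 / 2) : ℂ) * hqr
  have hinv : ∀ v, (T * flowMatrix n r)⁻¹ *ᵥ ((T * flowMatrix n r) *ᵥ v) = v := fun v => by
    rw [mulVec_mulVec, Matrix.nonsing_inv_mul _ hA.isUnit_det, one_mulVec]
  refine ⟨r, ψ, (T * flowMatrix n r)⁻¹ * mat g, isRotation_of_preservesForm
    (preservesForm_mul hA.inv (preservesForm_mat g)) ?_ ?_, ?_⟩
  · rw [← mulVec_mulVec, hgp, mulVec_smul, hinv]
  · rw [← mulVec_mulVec, hgq, mulVec_smul, hinv]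
  · rw [← Matrix.mul_assoc, Matrix.mul_nonsing_inv _ hA.isUnit_det, Matrix.one_mul]

end Lifts

end ComplexHyperbolic

/-! ### The period formula -/

open ComplexHyperbolic in
theorem mainTheorem4 (n : ℕ) [NeZero n]
    (κ : ℚ) (hκ : κ ∈ weightSet n) (m : ℕ) (hm : (m : ℚ) = ((n : ℚ) + 1) * κ)
    (μ : MeasureTheory.Measure (SU n)) [μ.IsHaarMeasure]
    (hμ : MeasureTheory.Measure.map (fun g : SU n => act g 0) μ = hypVolume n)
    (Γ : Subgroup (SU n)) (hΓ : IsLattice Γ μ)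
    (D : Set (SU n)) (hD : MeasureTheory.IsFundamentalDomain Γ D μ)
    (f : (Fin n → ℂ) → ℂ) (hf : IsCuspForm Γ m f)
    (γ₀ : Γ) (hγ₀ : IsLoxodromic (γ₀ : SU n))
    (X Y : Fin n ⊕ Unit → ℂ)
    (hX : IsAttracting (γ₀ : SU n) X) (hY : IsRepelling (γ₀ : SU n) Y)
    (hq : ∀ z ∈ ball n, slash m (qForm X Y m) (γ₀ : SU n) z = qForm X Y m z) :
    (∀ z ∈ ball n, Summable (thetaTerm γ₀ X Y m z)) ∧
    MeasureTheory.IntegrableOn (peterssonIntegrand m f (theta γ₀ X Y m)) D μ ∧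
    ∀ T : Matrix (Fin n ⊕ Unit) (Fin n ⊕ Unit) ℂ, IsReferenceFrame X Y T →
    ∀ (g : SU n) (s : ℝ), IsGeodesicLift (γ₀ : SU n) g s →
      (∃ (r ψ : ℝ) (w : Matrix (Fin n ⊕ Unit) (Fin n ⊕ Unit) ℂ),
        IsRotation ψ w ∧ mat g = T * flowMatrix n r * w) ∧
      ∀ (r ψ : ℝ) (w : Matrix (Fin n ⊕ Unit) (Fin n ⊕ Unit) ℂ),
        IsRotation ψ w → mat g = T * flowMatrix n r * w →
        petersson μ D m f (theta γ₀ X Y m) =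
          Complex.exp (-(2 * m * Complex.I * ψ)) * (alpha X Y ^ m)⁻¹ * (periodConst n m : ℂ) *
            ∫ t in (0 : ℝ)..s, lift m f (g * flow n t) := by
  have hnm : n + 1 ≤ m := by
    have h1 : ((n + 1 : ℕ) : ℚ) ≤ m := by
      rw [hm]
      push_cast
      exact le_mul_of_one_le_right (by positivity) hκ.1
    exact_mod_cast h1
  have hinj := hX.injective_zpow
  have hq0 := hq 0 zero_mem_ball
  -- The axis given by loxodromy serves only for convergence; the formula is derived again below
  -- with `h = g`.
  obtain ⟨h, s₀, ζ₀, c₀, hs₀, hc₀, hc, hP, hQ⟩ := exists_frame_of_isLoxodromic hγ₀ hX hY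
  obtain ⟨hsum, hint, -⟩ := petersson_theta_of_translatesGeodesic hμ hnm hΓ hD hf hX.null
    (IsAttracting.null hY) hc₀ hc hinj hs₀ (translatesGeodesic_of_eigen hc₀ hc hq0 hP hQ)
  refine ⟨hsum, hint, fun T hT g s H => ⟨exists_isRotation_of_isGeodesicLift hX hY hT H,
    fun r ψ w hw hg => ?_⟩⟩
  have hω := hX.herm_ne_zero hY
  obtain ⟨l, -, hlX⟩ := hX.eigen
  obtain ⟨k, hkY⟩ := hY.eigen_inv
  have hgP : mat g *ᵥ nullPlus n =
      (Complex.exp (-(Complex.I * ψ)) * Complex.exp r * (herm X Y)⁻¹) • X := by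
    rw [hg, ← mulVec_mulVec, hw.mulVec_nullPlus, mulVec_smul, ← mulVec_mulVec,
      flowMatrix_mulVec_nullPlus, mulVec_smul, hT.mulVec_nullPlus, smul_smul, smul_smul]
  have hgQ : mat g *ᵥ nullMinus n =
      (Complex.exp (-(Complex.I * ψ)) * Complex.exp (-r) * -(1 / 2)) • Y := by
    rw [hg, ← mulVec_mulVec, hw.mulVec_nullMinus, mulVec_smul, ← mulVec_mulVec,
      flowMatrix_mulVec_nullMinus, mulVec_smul, hT.mulVec_nullMinus, smul_smul, smul_smul]
  have hgP0 : Complex.exp (-(Complex.I * ψ)) * Complex.exp r * (herm X Y)⁻¹ ≠ 0 :=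
    mul_ne_zero (mul_ne_zero (Complex.exp_ne_zero _) (Complex.exp_ne_zero _)) (inv_ne_zero hω)
  have hgQ0 : Complex.exp (-(Complex.I * ψ)) * Complex.exp (-r) * -(1 / 2) ≠ 0 :=
    mul_ne_zero (mul_ne_zero (Complex.exp_ne_zero _) (Complex.exp_ne_zero _)) (by norm_num)
  have hcg := herm_mul_herm_of_smul hgP hgQ hgP0 hgQ0
  have hγP : mat (γ₀ : SU n) *ᵥ (mat g *ᵥ nullPlus n) = l • (mat g *ᵥ nullPlus n) := by
    rw [hgP, mulVec_smul, hlX, smul_comm]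
  have hγQ : mat (γ₀ : SU n) *ᵥ (mat g *ᵥ nullMinus n) = k • (mat g *ᵥ nullMinus n) := by
    rw [hgQ, mulVec_smul, hkY, smul_comm]
  -- The lift condition ties the two eigenvalues together as `ζe^s` and `ζe^{-s}`, with `s` its own
  -- length.
  obtain ⟨ζ, rfl, rfl⟩ := H.exists_eigen hγP hγQ
  have hc0 := star_ne_zero.2 (inv_ne_zero (mul_ne_zero hgP0 hgQ0))
  have key := (petersson_theta_of_translatesGeodesic hμ hnm hΓ hD hf hX.null
    (IsAttracting.null hY) hc0 hcg hinj H.1.ne'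
    (translatesGeodesic_of_eigen hc0 hcg hq0 hγP hγQ)).2.2
  rw [key, abs_of_pos H.1, ← intervalIntegral.integral_of_le H.1.le, ← mul_assoc, alpha,
    ← petersson_const]
  congr 2
  -- `e^r` and `e^{-r}` cancel, so the formula does not depend on `r`; the two equal phases give
  -- `e^{2iψ}`, whose inverse `m`-th power is the factor in the theorem.
  have e : (Complex.exp (-(Complex.I * ψ)) * Complex.exp r * (herm X Y)⁻¹ *
      (Complex.exp (-(Complex.I * ψ)) * Complex.exp (-r) * -(1 / 2)))⁻¹ =
      4 * (-(herm X Y) / 2) * Complex.exp (2 * Complex.I * ψ) := by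
    have e1 : Complex.exp r * Complex.exp (-r) = 1 := by rw [← Complex.exp_add]; simp
    have e2 : Complex.exp (-(Complex.I * ψ)) * Complex.exp (-(Complex.I * ψ)) *
        Complex.exp (2 * Complex.I * ψ) = 1 := by
      rw [← Complex.exp_add, ← Complex.exp_add, ← Complex.exp_zero]
      congr 1; ring
    refine inv_eq_of_mul_eq_one_right ?_
    have e3 := mul_inv_cancel₀ hω
    generalize Complex.exp (-(Complex.I * ψ)) = A at *
    generalize Complex.exp (2 * Complex.I * ψ) = B at *
    generalize Complex.exp r = R at *
    generalize Complex.exp (-r) = R' at *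
    generalize (herm X Y)⁻¹ = Z at *
    generalize herm X Y = Z' at *
    linear_combination (A * A * B * Z' * Z) * e1 + (Z' * Z) * e2 + e3
  rw [e, star_inv₀, star_mul', star_pow, star_star]
  simp
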